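/- For a real $3\times 3$ matrix $F$ with $\det F>0$ (i.e. $F\in \mathrm{GL}^+(3)$) let $U=\sqrt{F^TF}$ be its right stretch tensor, a symmetric positive definite matrix, and let $\log U$ be the principal (symmetric) logarithm of $U$. Write $\operatorname{dev}_3 X = X-\tfrac13\operatorname{tr}(X)\,\mathbb{1}$ and $\|X\|^2=\operatorname{tr}(X^TX)$ (Frobenius norm), and consider the energy $W(F)=\|\operatorname{dev}_3\log U\|^2$ on $\mathrm{GL}^+(3)$. Call $W$ Legendre–Hadamard elliptic at $F$ if $W$ is of class $C^2$ near $F$ and $$D^2W(F).(\xi\otimes\eta,\xi\otimes\eta)\ge 0\qquad\text{for all }\xi,\eta\in\mathbb{R}^3 ;$$ the maximal ellipticity domain of $W$ is the set of all $F\in\mathrm{GL}^+(3)$ at which $W$ is Legendre–Hadamard elliptic. Proposition. The maximal ellipticity domain of $W$ contains every $F\in \mathrm{GL}^+(3)$ whose stretch $U$ lies in $$\Big\{U\ \text{symmetric positive definite}\ \Big|\ \|\operatorname{dev}_3\log U\|^2\le \tfrac23\Big\}.$$ Moreover, if $\lambda_1,\lambda_2,\lambda_3$ are the eigenvalues of $U$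 (with multiplicity, in any order) and $a=\log(\lambda_1/\lambda_2)$, $b=\log(\lambda_2/\lambda_3)$, then $\|\operatorname{dev}_3\log U\|^2\le\frac23$ holds if and only if $a^2+b^2+ab\le 1$. -/

import Mathlib

/-- `GL⁺(n)`, the real `n × n` matrices with positive determinant. -/
def GLPos (n : ℕ) : Set (Matrix (Fin n) (Fin n) ℝ) := {F | 0 < F.det}

/-- `PSym(n)`, the symmetric positive definite real `n × n` matrices. -/
def PSym (n : ℕ) : Set (Matrix (Fin n) (Fin n) ℝ) := {U | U.PosDef}

/-- The right stretch tensor `U = √(FᵀF)`: the square root is applied to the eigenvalues of the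
symmetric matrix `FᵀF` (spectral functional calculus). -/
noncomputable def stretch {n : ℕ} (F : Matrix (Fin n) (Fin n) ℝ) : Matrix (Fin n) (Fin n) ℝ :=
  cfc Real.sqrt (F.transpose * F)

/-- The principal matrix logarithm of a symmetric positive definite matrix: the real logarithm is
applied to the eigenvalues (spectral functional calculus). -/
noncomputable def matLog {n : ℕ} (U : Matrix (Fin n) (Fin n) ℝ) : Matrix (Fin n) (Fin n) ℝ :=
  cfc Real.log U

/-- The deviatoric part `dev_n X = X - (1/n) tr(X) 1`. -/
noncomputable def dev {n : ℕ} (X : Matrix (Fin n) (Fin n) ℝ) : Matrix (Fin n) (Fin n) ℝ :=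
  X - ((1 / (n : ℝ)) * X.trace) • (1 : Matrix (Fin n) (Fin n) ℝ)

-- From here on, real matrices carry the Frobenius norm.
attribute [local instance] Matrix.frobeniusNormedAddCommGroup Matrix.frobeniusNormedSpace

/-- The isochoric energy `F ↦ ‖dev_n log U‖²` with `U = √(FᵀF)` (Frobenius norm). Only its values
on the open set `GL⁺(n)` matter. -/
noncomputable def isoEnergy (n : ℕ) (F : Matrix (Fin n) (Fin n) ℝ) : ℝ :=
  ‖dev (matLog (stretch F))‖ ^ 2

/-- `W` is Legendre-Hadamard elliptic at `F`: `W` is of class `C²` near `F`, and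
`D²W(F).(ξ ⊗ η, ξ ⊗ η) ≥ 0` for all vectors `ξ, η`. -/
def IsLHEllipticAt {n : ℕ} (W : Matrix (Fin n) (Fin n) ℝ → ℝ)
    (F : Matrix (Fin n) (Fin n) ℝ) : Prop :=
  ContDiffAt ℝ 2 W F ∧
    ∀ ξ η : Fin n → ℝ,
      0 ≤ iteratedFDeriv ℝ 2 W F ![Matrix.vecMulVec ξ η, Matrix.vecMulVec ξ η]

/-- The maximal ellipticity domain of `W` on `GL⁺(n)`: the set of all points at which `W` is
Legendre-Hadamard elliptic. -/
def maximalEllipticityDomain {n : ℕ} (W : Matrix (Fin n) (Fin n) ℝ → ℝ) :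
    Set (Matrix (Fin n) (Fin n) ℝ) :=
  {F | F ∈ GLPos n ∧ IsLHEllipticAt W F}

/-- The set of stretches `{U ∈ PSym(n) | ‖dev_n log U‖² ≤ c}`. -/
def stretchDomain (n : ℕ) (c : ℝ) : Set (Matrix (Fin n) (Fin n) ℝ) :=
  {U | U ∈ PSym n ∧ ‖dev (matLog U)‖ ^ 2 ≤ c}

/-! By singular value decomposition and orthogonal invariance, everything reduces to a diagonal
matrix with positive entries `l i`, where the energy is the variance-type sum `stretchEnergy`. For
distinct entries, infinitesimal rotations on both sides remove the off-diagonal part of a direction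
`H`, which yields the explicit Hessian `isoEnergy_second_derivative`. With `d i = log (l i) - mean`,
`y i = H i i / l i` and `H` of rank one, half the Hessian is a quadratic form in the `y i` plus one
shear term for each pair of stretches. `pair_contribution_bounds` bounds each shear term below by a
multiple of `y i * y j` that depends on the sign of the product. What remains,
`quadraticForm_nonneg`, is algebra under `∑ d i = 0` and `∑ d i ^ 2 ≤ 2/3`. Coinciding stretches
follow by approximation, since the energy is `C²` and the bound is convex in the logarithms. -/

/-! ### Spectral calculus and singular values. -/

open Matrix in
/-- Conjugation of diagonal matrices by an orthogonal matrix, as an algebra homomorphism. -/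
def conjDiagonal {n : ℕ} (R : Matrix (Fin n) (Fin n) ℝ) (hR : Rᵀ * R = 1) :
    (Fin n → ℝ) →ₐ[ℝ] Matrix (Fin n) (Fin n) ℝ where
  toFun y := Rᵀ * diagonal y * R
  map_one' := by simp [hR]
  map_zero' := by simp
  map_add' x y := by
    have h : diagonal (x + y) = diagonal x + diagonal y := (diagonal_add x y).symm
    rw [h, Matrix.mul_add, Matrix.add_mul]
  map_mul' x y := by
    have hR' : R * Rᵀ = 1 := mul_eq_one_comm.mp hR
    have h : diagonal (x * y) = diagonal x * diagonal y := (diagonal_mul_diagonal x y).symm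
    calc Rᵀ * diagonal (x * y) * R = Rᵀ * diagonal x * 1 * diagonal y * R := by
          rw [h, Matrix.mul_one]; simp only [Matrix.mul_assoc]
      _ = _ := by rw [← hR']; simp only [Matrix.mul_assoc]
  commutes' r := by
    have h : diagonal (algebraMap ℝ (Fin n → ℝ) r) = r • (1 : Matrix (Fin n) (Fin n) ℝ) := by
      ext i j
      by_cases hij : i = j
      · subst hij; simp
      · simp [hij]
    rw [h, Matrix.mul_smul, Matrix.smul_mul, Matrix.mul_one, hR, Algebra.algebraMap_eq_smul_one]

open Matrix in
lemma conjDiagonal_apply {n : ℕ} (R : Matrix (Fin n) (Fin n) ℝ) (hR : Rᵀ * R = 1)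
    (y : Fin n → ℝ) : conjDiagonal R hR y = Rᵀ * diagonal y * R := rfl

open Matrix in
lemma isHermitian_conjDiagonal {n : ℕ} (R : Matrix (Fin n) (Fin n) ℝ) (y : Fin n → ℝ) :
    (Rᵀ * diagonal y * R).IsHermitian := by
  rw [IsHermitian, conjTranspose_eq_transpose_of_trivial]
  simp [Matrix.mul_assoc]

-- On the finite spectrum `f` agrees with its Lagrange interpolation polynomial, and polynomials
-- commute with the algebra homomorphism `conjDiagonal`.
open Matrix in
lemma cfc_conjDiagonal {n : ℕ} (R : Matrix (Fin n) (Fin n) ℝ) (hR : Rᵀ * R = 1)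
    (y : Fin n → ℝ) (f : ℝ → ℝ) :
    cfc f (Rᵀ * diagonal y * R) = Rᵀ * diagonal (fun i => f (y i)) * R := by
  classical
  have hsa : IsSelfAdjoint (Rᵀ * diagonal y * R) := isHermitian_conjDiagonal R y
  let p : Polynomial ℝ := Lagrange.interpolate (Finset.univ.image y) id f
  have hp : ∀ i, p.eval (y i) = f (y i) := fun i =>
    Lagrange.eval_interpolate_at_node (s := Finset.univ.image y) (v := id) f
      (Function.injective_id.injOn) (Finset.mem_image_of_mem y (Finset.mem_univ i))
  have hspec : ∀ x ∈ spectrum ℝ (Rᵀ * diagonal y * R), ∃ i, y i = x := by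
    intro x hx
    have h1 := AlgHom.spectrum_apply_subset (conjDiagonal R hR) y hx
    rw [Pi.spectrum_eq] at h1
    obtain ⟨i, hi⟩ := Set.mem_iUnion.mp h1
    have h2 : spectrum ℝ (y i) = {y i} := spectrum.scalar_eq (A := ℝ) (y i)
    rw [h2] at hi
    exact ⟨i, (Set.mem_singleton_iff.mp hi).symm⟩
  have hcongr : cfc f (Rᵀ * diagonal y * R) = cfc p.eval (Rᵀ * diagonal y * R) := by
    apply cfc_congr
    intro x hx
    obtain ⟨i, rfl⟩ := hspec x hx
    exact (hp i).symm
  rw [hcongr, cfc_polynomial p _ hsa, ← conjDiagonal_apply R hR y, Polynomial.aeval_algHom_apply,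
    conjDiagonal_apply]
  congr 3
  ext i
  have := Polynomial.aeval_algHom_apply (Pi.evalAlgHom ℝ (fun _ : Fin n => ℝ) i) y p
  simp only [Pi.evalAlgHom_apply] at this
  rw [← this, ← hp i]
  simp [Polynomial.aeval_def, Polynomial.eval₂_eq_eval_map]

open Matrix in
lemma transpose_mul_self_svd {n : ℕ} (Q R : Matrix (Fin n) (Fin n) ℝ) (hQ : Qᵀ * Q = 1)
    (l : Fin n → ℝ) :
    (Q * diagonal l * R)ᵀ * (Q * diagonal l * R) = Rᵀ * diagonal (fun i => l i ^ 2) * R := by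
  have h : diagonal (fun i => l i ^ 2) = diagonal l * diagonal l := by
    rw [diagonal_mul_diagonal]; simp [sq]
  rw [transpose_mul, transpose_mul, diagonal_transpose, h]
  calc Rᵀ * (diagonal l * Qᵀ) * (Q * diagonal l * R)
      = Rᵀ * diagonal l * (Qᵀ * Q) * diagonal l * R := by simp only [Matrix.mul_assoc]
    _ = _ := by rw [hQ]; simp only [Matrix.mul_assoc, Matrix.one_mul]

open Matrix in
lemma stretch_svd {n : ℕ} (Q R : Matrix (Fin n) (Fin n) ℝ) (hQ : Qᵀ * Q = 1) (hR : Rᵀ * R = 1)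
    (l : Fin n → ℝ) (hl : ∀ i, 0 < l i) :
    stretch (Q * diagonal l * R) = Rᵀ * diagonal l * R := by
  rw [stretch, transpose_mul_self_svd Q R hQ, cfc_conjDiagonal R hR]
  congr 3
  ext i
  exact Real.sqrt_sq (hl i).le

open Matrix in
lemma matLog_conjDiagonal {n : ℕ} (R : Matrix (Fin n) (Fin n) ℝ) (hR : Rᵀ * R = 1)
    (l : Fin n → ℝ) :
    matLog (Rᵀ * diagonal l * R) = Rᵀ * diagonal (fun i => Real.log (l i)) * R :=
  cfc_conjDiagonal R hR l Real.log

open Matrix in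
lemma trace_conjDiagonal {n : ℕ} (R : Matrix (Fin n) (Fin n) ℝ) (hR : Rᵀ * R = 1)
    (y : Fin n → ℝ) : (Rᵀ * diagonal y * R).trace = ∑ i, y i := by
  rw [Matrix.trace_mul_cycle, mul_eq_one_comm.mp hR, Matrix.one_mul, trace_diagonal]

open Matrix in
lemma frobenius_norm_sq_eq_sum {n : ℕ} (X : Matrix (Fin n) (Fin n) ℝ) :
    ‖X‖ ^ 2 = ∑ i, ∑ j, X i j ^ 2 := by
  rw [frobenius_norm_def, ← Real.sqrt_eq_rpow, Real.sq_sqrt (by positivity)]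
  simp

open Matrix in
lemma frobenius_norm_sq_eq_trace {n : ℕ} (X : Matrix (Fin n) (Fin n) ℝ) :
    ‖X‖ ^ 2 = (Xᵀ * X).trace := by
  rw [frobenius_norm_sq_eq_sum, Finset.sum_comm]
  simp [Matrix.trace, Matrix.mul_apply, sq]

open Matrix in
lemma dev_conjDiagonal {n : ℕ} (R : Matrix (Fin n) (Fin n) ℝ) (hR : Rᵀ * R = 1)
    (y : Fin n → ℝ) :
    dev (Rᵀ * diagonal y * R)
      = Rᵀ * diagonal (fun i => y i - 1 / (n : ℝ) * ∑ j, y j) * R := by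
  rw [dev, trace_conjDiagonal R hR]
  have h : diagonal (fun i => y i - 1 / (n : ℝ) * ∑ j, y j)
      = diagonal y - (1 / (n : ℝ) * ∑ j, y j) • (1 : Matrix (Fin n) (Fin n) ℝ) := by
    ext i j
    by_cases hij : i = j
    · subst hij; simp
    · simp [hij]
  rw [h, Matrix.mul_sub, Matrix.sub_mul, Matrix.mul_smul, Matrix.smul_mul, Matrix.mul_one, hR]

/-- The isochoric energy as a function of the principal stretches. -/
noncomputable def stretchEnergy {n : ℕ} (l : Fin n → ℝ) : ℝ :=
  ∑ i, (Real.log (l i) - 1 / (n : ℝ) * ∑ j, Real.log (l j)) ^ 2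

open Matrix in
lemma norm_sq_dev_conjDiagonal {n : ℕ} (R : Matrix (Fin n) (Fin n) ℝ) (hR : Rᵀ * R = 1)
    (y : Fin n → ℝ) :
    ‖dev (Rᵀ * diagonal y * R)‖ ^ 2 = ∑ i, (y i - 1 / (n : ℝ) * ∑ j, y j) ^ 2 := by
  rw [dev_conjDiagonal R hR, frobenius_norm_sq_eq_trace, transpose_mul_self_svd Rᵀ R,
    trace_conjDiagonal R hR]
  rw [transpose_transpose]
  exact mul_eq_one_comm.mp hR

open Matrix in
lemma isoEnergy_svd {n : ℕ} (Q R : Matrix (Fin n) (Fin n) ℝ) (hQ : Qᵀ * Q = 1) (hR : Rᵀ * R = 1)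
    (l : Fin n → ℝ) (hl : ∀ i, 0 < l i) :
    isoEnergy n (Q * diagonal l * R) = stretchEnergy l := by
  rw [isoEnergy, stretch_svd Q R hQ hR l hl, matLog_conjDiagonal R hR,
    norm_sq_dev_conjDiagonal R hR, stretchEnergy]

open Matrix in
lemma exists_conjDiagonal {n : ℕ} (A : Matrix (Fin n) (Fin n) ℝ) (hA : A.PosDef) :
    ∃ (R : Matrix (Fin n) (Fin n) ℝ) (l : Fin n → ℝ), Rᵀ * R = 1 ∧ (∀ i, 0 < l i) ∧
      A = Rᵀ * diagonal l * R := by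
  let V := hA.isHermitian.eigenvectorUnitary
  refine ⟨(V : Matrix (Fin n) (Fin n) ℝ)ᵀ, hA.isHermitian.eigenvalues, ?_,
    hA.eigenvalues_pos, ?_⟩
  · have := Unitary.coe_mul_star_self V
    rw [transpose_transpose]
    rwa [Unitary.coe_star, star_eq_conjTranspose, conjTranspose_eq_transpose_of_trivial] at this
  · have := hA.isHermitian.spectral_theorem
    rw [Unitary.conjStarAlgAut_apply, star_eq_conjTranspose,
      conjTranspose_eq_transpose_of_trivial] at this
    rw [transpose_transpose]
    exact this

open Matrix in
/-- Singular value decomposition of an invertible real matrix. -/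
lemma exists_svd {n : ℕ} (F : Matrix (Fin n) (Fin n) ℝ) (hF : F.det ≠ 0) :
    ∃ (Q R : Matrix (Fin n) (Fin n) ℝ) (l : Fin n → ℝ), Qᵀ * Q = 1 ∧ Rᵀ * R = 1 ∧
      (∀ i, 0 < l i) ∧ F = Q * diagonal l * R := by
  have hpd : (Fᵀ * F).PosDef := by
    have := Matrix.PosDef.conjTranspose_mul_self F
      (Matrix.mulVec_injective_iff_isUnit.mpr ((isUnit_iff_isUnit_det F).mpr hF.isUnit))
    rwa [conjTranspose_eq_transpose_of_trivial] at this
  obtain ⟨R, m, hR, hm, hE⟩ := exists_conjDiagonal _ hpd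
  have hR' : R * Rᵀ = 1 := mul_eq_one_comm.mp hR
  have hs : ∀ i, 0 < Real.sqrt (m i) := fun i => Real.sqrt_pos.mpr (hm i)
  refine ⟨F * Rᵀ * diagonal (fun i => (Real.sqrt (m i))⁻¹), R, fun i => Real.sqrt (m i), ?_, hR,
    hs, ?_⟩
  · rw [transpose_mul, transpose_mul, diagonal_transpose, transpose_transpose]
    calc _ = diagonal (fun i => (Real.sqrt (m i))⁻¹) * (R * (Fᵀ * F) * Rᵀ)
              * diagonal (fun i => (Real.sqrt (m i))⁻¹) := by simp only [Matrix.mul_assoc]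
      _ = diagonal (fun i => (Real.sqrt (m i))⁻¹) * ((R * Rᵀ) * diagonal m * (R * Rᵀ))
              * diagonal (fun i => (Real.sqrt (m i))⁻¹) := by
            rw [hE]; simp only [Matrix.mul_assoc]
      _ = 1 := by
          rw [hR', Matrix.one_mul, Matrix.mul_one, diagonal_mul_diagonal, diagonal_mul_diagonal,
            ← diagonal_one]
          congr 1
          ext i
          have h1 := (hs i).ne'
          have h2 := Real.mul_self_sqrt (hm i).le
          field_simp
          nlinarith
  · have h : diagonal (fun i => (Real.sqrt (m i))⁻¹) * diagonal (fun i => Real.sqrt (m i))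
        = 1 := by
      rw [diagonal_mul_diagonal, ← diagonal_one]
      congr 1
      ext i
      exact inv_mul_cancel₀ (hs i).ne'
    rw [Matrix.mul_assoc (F * Rᵀ), h, Matrix.mul_one, Matrix.mul_assoc, hR, Matrix.mul_one]

open Matrix in
/-- The isochoric energy is invariant under orthogonal changes of frame on both sides. -/
lemma isoEnergy_orthogonal_mul_mul {n : ℕ} (Q R F : Matrix (Fin n) (Fin n) ℝ) (hQ : Qᵀ * Q = 1)
    (hR : Rᵀ * R = 1) (hF : F.det ≠ 0) : isoEnergy n (Q * F * R) = isoEnergy n F := by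
  obtain ⟨P, S, l, hP, hS, hl, rfl⟩ := exists_svd F hF
  have h1 : (Q * P)ᵀ * (Q * P) = 1 := by
    rw [transpose_mul, Matrix.mul_assoc, ← Matrix.mul_assoc Qᵀ, hQ, Matrix.one_mul, hP]
  have h2 : (S * R)ᵀ * (S * R) = 1 := by
    rw [transpose_mul, Matrix.mul_assoc, ← Matrix.mul_assoc Sᵀ, hS, Matrix.one_mul, hR]
  have h3 : Q * (P * diagonal l * S) * R = (Q * P) * diagonal l * (S * R) := by
    simp only [Matrix.mul_assoc]
  rw [h3, isoEnergy_svd _ _ h1 h2 l hl, isoEnergy_svd _ _ hP hS l hl]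

/-! ### Smoothness of the energy. -/

/-- The algebra of bounded operators on `n`-dimensional Euclidean space. -/
abbrev EuclideanEnd (n : ℕ) : Type :=
  EuclideanSpace ℝ (Fin n) →L[ℝ] EuclideanSpace ℝ (Fin n)

open Matrix in
lemma norm_toEuclideanCLM_orthogonal_le {n : ℕ} (R : Matrix (Fin n) (Fin n) ℝ) (hR : Rᵀ * R = 1) :
    ‖(toEuclideanCLM (n := Fin n) (𝕜 := ℝ) R : EuclideanEnd n)‖ ≤ 1 := by
  refine ContinuousLinearMap.opNorm_le_bound _ zero_le_one fun x => ?_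
  have h1 : star (toEuclideanCLM (n := Fin n) (𝕜 := ℝ) R) * toEuclideanCLM (n := Fin n) (𝕜 := ℝ) R
      = 1 := by
    rw [← map_star, ← map_mul, star_eq_conjTranspose, conjTranspose_eq_transpose_of_trivial, hR,
      map_one]
  have h2 : ‖toEuclideanCLM (n := Fin n) (𝕜 := ℝ) R x‖ ^ 2 = ‖x‖ ^ 2 := by
    have h3 := DFunLike.congr_fun h1 x
    rw [← real_inner_self_eq_norm_sq, ← ContinuousLinearMap.adjoint_inner_left,
      ← ContinuousLinearMap.star_eq_adjoint, ← real_inner_self_eq_norm_sq]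
    exact congrArg (fun z => inner ℝ z x) h3
  rw [one_mul]
  exact ((sq_eq_sq₀ (norm_nonneg _) (norm_nonneg _)).mp h2).le

-- Turns `‖Y‖ < 1` in the operator norm into a bound on every eigenvalue. Orthogonal conjugation
-- does not increase the norm, and it can be undone.
open Matrix in
lemma norm_toEuclideanCLM_conjDiagonal {n : ℕ} (R : Matrix (Fin n) (Fin n) ℝ) (hR : Rᵀ * R = 1)
    (y : Fin n → ℝ) :
    ‖(toEuclideanCLM (n := Fin n) (𝕜 := ℝ) (Rᵀ * diagonal y * R) : EuclideanEnd n)‖ = ‖y‖ := by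
  have hR' : R * Rᵀ = 1 := mul_eq_one_comm.mp hR
  have hn := norm_toEuclideanCLM_orthogonal_le R hR
  have hn' := norm_toEuclideanCLM_orthogonal_le Rᵀ (by rwa [transpose_transpose])
  have hconj : ∀ (A B T : EuclideanEnd n), ‖A‖ ≤ 1 → ‖B‖ ≤ 1 → ‖A * T * B‖ ≤ ‖T‖ := by
    intro A B T hA hB
    calc ‖A * T * B‖ ≤ ‖A * T‖ * ‖B‖ := norm_mul_le _ _
      _ ≤ ‖A‖ * ‖T‖ * ‖B‖ := by gcongr; exact norm_mul_le _ _
      _ ≤ 1 * ‖T‖ * 1 := by gcongr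
      _ = ‖T‖ := by ring
  have hd : ‖(toEuclideanCLM (n := Fin n) (𝕜 := ℝ) (diagonal y) : EuclideanEnd n)‖ = ‖y‖ := by
    rw [← l2_opNorm_diagonal (𝕜 := ℝ) y]; rfl
  rw [← hd]
  apply le_antisymm
  · rw [map_mul, map_mul]
    exact hconj _ _ _ hn' hn
  · have h : diagonal y = R * (Rᵀ * diagonal y * R) * Rᵀ := by
      calc diagonal y = (R * Rᵀ) * diagonal y * (R * Rᵀ) := by simp [hR']
        _ = _ := by simp only [Matrix.mul_assoc]
    conv_lhs => rw [h]
    rw [map_mul, map_mul]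
    exact hconj _ _ _ hn hn'

/-- The power series `∑ Yᵏ / k`, that is `-log (1 - Y)`, in the operator algebra. -/
noncomputable def logSeries (n : ℕ) : FormalMultilinearSeries ℝ (EuclideanEnd n) (EuclideanEnd n) :=
  FormalMultilinearSeries.ofScalars (EuclideanEnd n) (fun k : ℕ => (k : ℝ)⁻¹)

lemma one_le_radius_logSeries (n : ℕ) : 1 ≤ (logSeries n).radius := by
  have h := FormalMultilinearSeries.inv_le_ofScalars_radius_of_tendsto (E := EuclideanEnd n)
    (fun k : ℕ => (k : ℝ)⁻¹) (r := 1) one_ne_zero ?_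
  · rw [logSeries]; simpa using h
  · have h1 : Filter.Tendsto (fun k : ℕ => (k : ℝ) / ((k : ℝ) + 1)) Filter.atTop (nhds 1) :=
      tendsto_natCast_div_add_atTop 1
    refine h1.congr fun k => ?_
    rw [Real.norm_of_nonneg (by positivity), Real.norm_of_nonneg (by positivity)]
    push_cast
    field_simp

lemma contDiffAt_logSeries_sum (n : ℕ) {m : WithTop ℕ∞} (Y : EuclideanEnd n) (hY : ‖Y‖ < 1) :
    ContDiffAt ℝ m (logSeries n).sum Y := by
  have h := (logSeries n).hasFPowerSeriesOnBall
    (lt_of_lt_of_le zero_lt_one (one_le_radius_logSeries n))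
  apply AnalyticAt.contDiffAt
  apply h.analyticAt_of_mem
  refine Metric.eball_subset_eball (one_le_radius_logSeries n) ?_
  rw [Metric.mem_eball, edist_zero_right]
  rw [← ofReal_norm]
  exact (ENNReal.ofReal_lt_one).mpr hY

open Matrix in
lemma logSeries_sum_conjDiagonal {n : ℕ} (R : Matrix (Fin n) (Fin n) ℝ) (hR : Rᵀ * R = 1)
    (y : Fin n → ℝ) (hy : ∀ i, |y i| < 1) :
    (logSeries n).sum (toEuclideanCLM (n := Fin n) (𝕜 := ℝ) (Rᵀ * diagonal y * R))
      = toEuclideanCLM (n := Fin n) (𝕜 := ℝ)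
          (Rᵀ * diagonal (fun i => -Real.log (1 - y i)) * R) := by
  have h1 : HasSum (fun k : ℕ => fun i => (k : ℝ)⁻¹ * y i ^ k)
      (fun i => -Real.log (1 - y i)) := by
    rw [Pi.hasSum]
    intro i
    -- The coefficient at `k = 0` is `0⁻¹ = 0`, so dropping that term leaves the usual logarithm
    -- series.
    rw [← hasSum_nat_add_iff' 1]
    have := Real.hasSum_pow_div_log_of_abs_lt_one (hy i)
    simp only [Finset.range_one, Finset.sum_singleton, Nat.cast_zero, _root_.inv_zero, zero_mul,
      sub_zero]
    have h : (fun k : ℕ => ((k + 1 : ℕ) : ℝ)⁻¹ * y i ^ (k + 1))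
        = fun k : ℕ => y i ^ (k + 1) / ((k : ℝ) + 1) := by
      funext k
      push_cast
      rw [inv_mul_eq_div]
    rw [h]
    exact this
  let ψ : (Fin n → ℝ) →ₗ[ℝ] EuclideanEnd n :=
    (toEuclideanCLM (n := Fin n) (𝕜 := ℝ)).toAlgEquiv.toLinearMap ∘ₗ (conjDiagonal R hR).toLinearMap
  have h2 := h1.mapL (LinearMap.toContinuousLinearMap ψ)
  have h3 : (logSeries n).sum (toEuclideanCLM (n := Fin n) (𝕜 := ℝ) (Rᵀ * diagonal y * R))
      = ∑' k : ℕ, ψ (fun i => (k : ℝ)⁻¹ * y i ^ k) := by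
    rw [logSeries, ← FormalMultilinearSeries.ofScalarsSum,
      FormalMultilinearSeries.ofScalarsSum_eq_tsum]
    refine tsum_congr fun k => ?_
    have h4 : (fun i => (k : ℝ)⁻¹ * y i ^ k) = (k : ℝ)⁻¹ • y ^ k := rfl
    rw [h4, map_smul]
    congr 1
    change _ = toEuclideanCLM (n := Fin n) (𝕜 := ℝ) (conjDiagonal R hR (y ^ k))
    rw [map_pow, map_pow]
    rfl
  rw [h3]
  exact h2.tsum_eq

open Matrix in
/-- The isochoric energy is smooth on the invertible matrices. -/
lemma contDiffAt_isoEnergy {n : ℕ} {m : WithTop ℕ∞} (F : Matrix (Fin n) (Fin n) ℝ)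
    (hF : F.det ≠ 0) : ContDiffAt ℝ m (isoEnergy n) F := by
  obtain ⟨Q, R, l, hQ, hR, hl, rfl⟩ := exists_svd F hF
  let Φ : Matrix (Fin n) (Fin n) ℝ →ₗ[ℝ] EuclideanEnd n :=
    (toEuclideanCLM (n := Fin n) (𝕜 := ℝ)).toAlgEquiv.toLinearMap
  have hΦ : ∀ X, Φ X = toEuclideanCLM (n := Fin n) (𝕜 := ℝ) X := fun _ => rfl
  -- Scaling by `c > l i ^ 2` puts the eigenvalues `1 - l i ^ 2 / c` of `Y` in `(0, 1)`, inside the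
  -- disc of convergence. Near the base point `log U` is then `G = (log c - series (Y)) / 2`.
  let c : ℝ := 1 + ∑ i, l i ^ 2
  have hc : 0 < c := by positivity
  have hlc : ∀ i, l i ^ 2 < c := fun i => by
    have := Finset.single_le_sum (f := fun i => l i ^ 2) (fun j _ => sq_nonneg (l j))
      (Finset.mem_univ i)
    linarith
  let Y : Matrix (Fin n) (Fin n) ℝ → EuclideanEnd n := fun F => 1 - c⁻¹ • (Φ Fᵀ * Φ F)
  have hY : ContDiff ℝ m Y := by
    have h1 : ContDiff ℝ m fun F : Matrix (Fin n) (Fin n) ℝ => Φ F :=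
      (LinearMap.toContinuousLinearMap Φ).contDiff
    have h2 : ContDiff ℝ m fun F : Matrix (Fin n) (Fin n) ℝ => Φ Fᵀ :=
      (LinearMap.toContinuousLinearMap
        (Φ ∘ₗ (transposeLinearEquiv (Fin n) (Fin n) ℝ ℝ).toLinearMap)).contDiff
    exact contDiff_const.sub ((h2.mul h1).const_smul c⁻¹)
  have hYsvd : ∀ (Q R : Matrix (Fin n) (Fin n) ℝ) (l : Fin n → ℝ), Qᵀ * Q = 1 →
      ∀ hR : Rᵀ * R = 1, Y (Q * diagonal l * R)
        = toEuclideanCLM (n := Fin n) (𝕜 := ℝ)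
            (Rᵀ * diagonal (fun i => 1 - c⁻¹ * l i ^ 2) * R) := by
    intro Q R l hQ hR
    simp only [Y, hΦ]
    rw [← map_mul, transpose_mul_self_svd Q R hQ, ← map_one (toEuclideanCLM (n := Fin n) (𝕜 := ℝ)),
      ← map_smul, ← map_sub, ← conjDiagonal_apply R hR, ← conjDiagonal_apply R hR,
      ← map_one (conjDiagonal R hR), ← map_smul, ← map_sub]
    rfl
  have hY0 : ‖Y (Q * diagonal l * R)‖ < 1 := by
    rw [hYsvd Q R l hQ hR, norm_toEuclideanCLM_conjDiagonal R hR, pi_norm_lt_iff one_pos]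
    intro i
    rw [Real.norm_eq_abs, abs_lt, inv_mul_eq_div]
    have h1 : l i ^ 2 / c < 1 := (div_lt_one hc).mpr (hlc i)
    have h2 : 0 < l i ^ 2 / c := div_pos (pow_pos (hl i) 2) hc
    constructor <;> linarith
  let ψ : Fin n → Fin n → EuclideanEnd n →ₗ[ℝ] ℝ := fun i j =>
    IsLinearMap.mk' (fun T => dev ((toEuclideanCLM (n := Fin n) (𝕜 := ℝ)).symm T) i j)
      { map_add := fun S T => by simp [dev, mul_add, add_mul]; ring
        map_smul := fun a T => by simp [dev]; ring }
  let G : Matrix (Fin n) (Fin n) ℝ → EuclideanEnd n := fun F =>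
    (1 / 2 : ℝ) • (Real.log c • (1 : EuclideanEnd n) - (logSeries n).sum (Y F))
  have hG : ContDiffAt ℝ m G (Q * diagonal l * R) :=
    (contDiffAt_const.sub ((contDiffAt_logSeries_sum n _ hY0).comp _ hY.contDiffAt)).const_smul _
  have hW : isoEnergy n =ᶠ[nhds (Q * diagonal l * R)]
      fun F => ∑ i, ∑ j, (ψ i j (G F)) ^ 2 := by
    have hdet : ∀ᶠ F in nhds (Q * diagonal l * R), F.det ≠ 0 :=
      (Continuous.matrix_det continuous_id).continuousAt.eventually_ne hF
    have hnorm : ∀ᶠ F in nhds (Q * diagonal l * R), ‖Y F‖ < 1 :=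
      (hY.continuous.norm).continuousAt.eventually_lt continuousAt_const hY0
    filter_upwards [hdet, hnorm] with F hF hF1
    obtain ⟨P, S, k, hP, hS, hk, rfl⟩ := exists_svd F hF
    rw [hYsvd P S k hP hS, norm_toEuclideanCLM_conjDiagonal S hS, pi_norm_lt_iff one_pos] at hF1
    have hGF : G (P * diagonal k * S) = toEuclideanCLM (n := Fin n) (𝕜 := ℝ)
        (Sᵀ * diagonal (fun i => Real.log (k i)) * S) := by
      simp only [G]
      rw [hYsvd P S k hP hS, logSeries_sum_conjDiagonal S hS _ hF1,
        ← map_one (toEuclideanCLM (n := Fin n) (𝕜 := ℝ)), ← map_smul, ← map_sub, ← map_smul,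
        ← conjDiagonal_apply S hS, ← conjDiagonal_apply S hS, ← map_one (conjDiagonal S hS),
        ← map_smul, ← map_sub, ← map_smul]
      congr 2
      ext i
      have : Real.log (1 - (1 - c⁻¹ * k i ^ 2)) = 2 * Real.log (k i) - Real.log c := by
        rw [sub_sub_cancel, Real.log_mul (inv_ne_zero hc.ne') (pow_ne_zero 2 (hk i).ne'),
          Real.log_inv, Real.log_pow]
        push_cast; ring
      simp only [Pi.smul_apply, Pi.sub_apply, Pi.one_apply, smul_eq_mul, this]
      ring
    simp only [ψ, IsLinearMap.mk'_apply, hGF, StarAlgEquiv.symm_apply_apply]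
    rw [isoEnergy, stretch_svd P S hP hS k hk, matLog_conjDiagonal S hS, frobenius_norm_sq_eq_sum]
  refine ContDiffAt.congr_of_eventuallyEq ?_ hW
  refine ContDiffAt.sum fun i _ => ContDiffAt.sum fun j _ => ContDiffAt.pow ?_ 2
  exact (LinearMap.toContinuousLinearMap (ψ i j)).contDiff.contDiffAt.comp _ hG

/-! ### Second derivatives along curves, and the Hessian at a diagonal matrix. -/

section SecondOrderChainRule

variable {E : Type*} [NormedAddCommGroup E] [NormedSpace ℝ E]

/-- The formula is needed on a neighbourhood of `0`, so that it can be differentiated once more. -/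
lemma eventually_hasDerivAt_comp_curve {f : E → ℝ} {y y' : ℝ → E}
    (hf : ContDiffAt ℝ 2 f (y 0)) (hy : ∀ t, HasDerivAt y (y' t) t) :
    ∀ᶠ t in nhds (0 : ℝ), HasDerivAt (fun s => f (y s)) (fderiv ℝ f (y t) (y' t)) t := by
  have h1 : ∀ᶠ x in nhds (y 0), DifferentiableAt ℝ f x :=
    (hf.eventually (by simp)).mono fun x hx => hx.differentiableAt (by simp)
  filter_upwards [(hy 0).continuousAt.eventually h1] with t ht
  exact ht.hasFDerivAt.comp_hasDerivAt t (hy t)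

lemma hasDerivAt_fderiv_curve {f : E → ℝ} {y y' : ℝ → E} {y'' : E}
    (hf : ContDiffAt ℝ 2 f (y 0)) (hy : ∀ t, HasDerivAt y (y' t) t)
    (hy' : HasDerivAt y' y'' 0) :
    HasDerivAt (fun t => fderiv ℝ f (y t) (y' t))
      (fderiv ℝ (fderiv ℝ f) (y 0) (y' 0) (y' 0) + fderiv ℝ f (y 0) y'') 0 := by
  have h1 : DifferentiableAt ℝ (fderiv ℝ f) (y 0) :=
    (hf.fderiv_right (m := 1) (by norm_num)).differentiableAt (by simp)
  exact (h1.hasFDerivAt.comp_hasDerivAt 0 (hy 0)).clm_apply hy'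

/-- Two functions that agree near `0` along two curves have the same second-order chain rule
expansions. -/
lemma fderiv_curve_eq {f g : ℝ → ℝ} {f' g' : ℝ → ℝ} {f'' g'' : ℝ}
    (hfg : f =ᶠ[nhds 0] g)
    (hf : ∀ᶠ t in nhds (0 : ℝ), HasDerivAt f (f' t) t)
    (hg : ∀ᶠ t in nhds (0 : ℝ), HasDerivAt g (g' t) t)
    (hf' : HasDerivAt f' f'' 0) (hg' : HasDerivAt g' g'' 0) : f' 0 = g' 0 ∧ f'' = g'' := by
  have h : f' =ᶠ[nhds 0] g' := by
    filter_upwards [hfg.eventuallyEq_nhds, hf, hg] with t h1 h2 h3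
    exact h2.unique (h3.congr_of_eventuallyEq h1)
  exact ⟨h.eq_of_nhds, hf'.unique (hg'.congr_of_eventuallyEq h)⟩

end SecondOrderChainRule

section OrthogonalCurves

attribute [local instance] Matrix.frobeniusNormedRing Matrix.frobeniusNormedAlgebra

open Matrix in
lemma exp_smul_skew_orthogonal {n : ℕ} (A : Matrix (Fin n) (Fin n) ℝ) (hA : Aᵀ = -A) (t : ℝ) :
    (NormedSpace.exp (t • A))ᵀ * NormedSpace.exp (t • A) = 1 := by
  rw [← exp_transpose, transpose_smul, hA, smul_neg, Matrix.exp_neg]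
  exact nonsing_inv_mul _ ((isUnit_iff_isUnit_det _).mp (Matrix.isUnit_exp _))

open Matrix in
lemma hasDerivAt_exp_mul_mul_exp {n : ℕ} (A B D H : Matrix (Fin n) (Fin n) ℝ) (t : ℝ) :
    HasDerivAt (fun t : ℝ => NormedSpace.exp (t • A) * (D + t • H) * NormedSpace.exp (t • B))
      (A * (NormedSpace.exp (t • A) * (D + t • H) * NormedSpace.exp (t • B))
        + NormedSpace.exp (t • A) * H * NormedSpace.exp (t • B)
        + NormedSpace.exp (t • A) * (D + t • H) * NormedSpace.exp (t • B) * B) t := by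
  have h1 : HasDerivAt (fun t : ℝ => NormedSpace.exp (t • A)) (A * NormedSpace.exp (t • A)) t :=
    hasDerivAt_exp_smul_const' A t
  have h2 : HasDerivAt (fun t : ℝ => NormedSpace.exp (t • B)) (NormedSpace.exp (t • B) * B) t :=
    hasDerivAt_exp_smul_const B t
  have h3 : HasDerivAt (fun t : ℝ => D + t • H) H t := by
    exact (((hasDerivAt_id t).smul_const H).const_add D).congr_deriv (one_smul ℝ H)
  refine ((h1.mul h3).mul h2).congr_deriv ?_
  simp only [Pi.mul_apply, Matrix.mul_assoc, Matrix.add_mul]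

open Matrix in
lemma hasDerivAt_deriv_exp_mul_mul_exp {n : ℕ} (A B D H : Matrix (Fin n) (Fin n) ℝ) :
    HasDerivAt (fun t : ℝ =>
        A * (NormedSpace.exp (t • A) * (D + t • H) * NormedSpace.exp (t • B))
        + NormedSpace.exp (t • A) * H * NormedSpace.exp (t • B)
        + NormedSpace.exp (t • A) * (D + t • H) * NormedSpace.exp (t • B) * B)
      (A * (A * D + H + D * B) + (A * H + H * B) + (A * D + H + D * B) * B) 0 := by
  have h1 := hasDerivAt_exp_mul_mul_exp A B D H 0
  -- The middle summand is the same kind of curve, with `H` in place of `D` and zero increment.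
  have h2 := hasDerivAt_exp_mul_mul_exp A B H 0 0
  simp only [smul_zero, add_zero, zero_smul, NormedSpace.exp_zero, Matrix.one_mul, Matrix.mul_one]
    at h1 h2
  exact ((h1.const_mul A).add h2).add (h1.mul_const B)

end OrthogonalCurves

section Energy

variable {n : ℕ}

open Matrix in
lemma eventually_isoEnergy_exp_mul_mul_exp (A B D H : Matrix (Fin n) (Fin n) ℝ)
    (hA : Aᵀ = -A) (hB : Bᵀ = -B) (hD : D.det ≠ 0) :
    ∀ᶠ t in nhds (0 : ℝ), isoEnergy n (D + t • H)
      = isoEnergy n (NormedSpace.exp (t • A) * (D + t • H) * NormedSpace.exp (t • B)) := by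
  have hcont : Continuous fun t : ℝ => (D + t • H).det := by fun_prop
  have : ∀ᶠ t in nhds (0 : ℝ), (D + t • H).det ≠ 0 :=
    hcont.continuousAt.eventually_ne (by simpa using hD)
  filter_upwards [this] with t ht
  exact (isoEnergy_orthogonal_mul_mul _ _ _ (exp_smul_skew_orthogonal A hA t)
    (exp_smul_skew_orthogonal B hB t) ht).symm

open Matrix in
/-- First and second derivatives of the isochoric energy are unchanged when the direction is
modified by an infinitesimal rotation on both sides, up to a second-order correction. -/
lemma isoEnergy_derivatives_rotate (A B D H : Matrix (Fin n) (Fin n) ℝ)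
    (hA : Aᵀ = -A) (hB : Bᵀ = -B) (hD : D.det ≠ 0) :
    fderiv ℝ (isoEnergy n) D H = fderiv ℝ (isoEnergy n) D (A * D + H + D * B) ∧
    fderiv ℝ (fderiv ℝ (isoEnergy n)) D H H
      = fderiv ℝ (fderiv ℝ (isoEnergy n)) D (A * D + H + D * B) (A * D + H + D * B)
        + fderiv ℝ (isoEnergy n) D
          (A * (A * D + H + D * B) + (A * H + H * B) + (A * D + H + D * B) * B) := by
  have hf : ContDiffAt ℝ 2 (isoEnergy n) D := contDiffAt_isoEnergy D hD
  have hy : ∀ t : ℝ, HasDerivAt (fun t : ℝ => D + t • H) H t := fun t => by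
    exact (((hasDerivAt_id t).smul_const H).const_add D).congr_deriv (one_smul ℝ H)
  have hf1 : ContDiffAt ℝ 2 (isoEnergy n) (D + (0 : ℝ) • H) := by simpa using hf
  have hf2 : ContDiffAt ℝ 2 (isoEnergy n) (NormedSpace.exp ((0 : ℝ) • A) * (D + (0 : ℝ) • H)
      * NormedSpace.exp ((0 : ℝ) • B)) := by
    simpa [NormedSpace.exp_zero] using hf
  -- The line `D + t • H` and its rotated image carry the same energy for small `t`. Comparing first
  -- and second derivatives at `0` gives both identities.
  have h := fderiv_curve_eq (eventually_isoEnergy_exp_mul_mul_exp A B D H hA hB hD)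
    (eventually_hasDerivAt_comp_curve (y := fun t : ℝ => D + t • H) hf1 hy)
    (eventually_hasDerivAt_comp_curve (y := fun t : ℝ => NormedSpace.exp (t • A) * (D + t • H)
      * NormedSpace.exp (t • B)) hf2 (hasDerivAt_exp_mul_mul_exp A B D H))
    (hasDerivAt_fderiv_curve (y := fun t : ℝ => D + t • H) hf1 hy (hasDerivAt_const 0 H))
    (hasDerivAt_fderiv_curve (y := fun t : ℝ => NormedSpace.exp (t • A) * (D + t • H)
      * NormedSpace.exp (t • B)) hf2 (hasDerivAt_exp_mul_mul_exp A B D H)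
      (hasDerivAt_deriv_exp_mul_mul_exp A B D H))
  simp only [add_zero, zero_smul, NormedSpace.exp_zero, Matrix.one_mul,
    Matrix.mul_one, map_zero] at h
  exact h

open Matrix in
lemma isoEnergy_diagonal (l : Fin n → ℝ) (hl : ∀ i, 0 < l i) :
    isoEnergy n (diagonal l) = stretchEnergy l := by
  simpa using isoEnergy_svd 1 1 (by simp) (by simp) l hl

open Matrix in
lemma isoEnergy_second_derivative_diagonal (l x w : Fin n → ℝ) (hl : ∀ i, 0 < l i) :
    fderiv ℝ (fderiv ℝ (isoEnergy n)) (diagonal l) (diagonal x) (diagonal x)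
        + fderiv ℝ (isoEnergy n) (diagonal l) (diagonal w)
      = ∑ i, (2 * (x i / l i - 1 / (n : ℝ) * ∑ j, x j / l j) ^ 2
        + 2 * (Real.log (l i) - 1 / (n : ℝ) * ∑ j, Real.log (l j))
          * ((w i / l i - (x i / l i) ^ 2)
            - 1 / (n : ℝ) * ∑ j, (w j / l j - (x j / l j) ^ 2))) := by
  have hdet : (diagonal l).det ≠ 0 := by
    rw [det_diagonal]; exact Finset.prod_ne_zero_iff.mpr fun i _ => (hl i).ne'
  -- A curve with position `l`, velocity `x` and acceleration `w` at `0`: the second derivative of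
  -- the energy along it is the left-hand side.
  let z : ℝ → Fin n → ℝ := fun t i => l i + t * x i + t ^ 2 / 2 * w i
  let z' : ℝ → Fin n → ℝ := fun t i => x i + t * w i
  have hz : ∀ t i, HasDerivAt (fun t => z t i) (z' t i) t := fun t i => by
    have h1 := ((hasDerivAt_id t).mul_const (x i)).const_add (l i)
    have h2 := (((hasDerivAt_id t).pow 2).div_const 2).mul_const (w i)
    refine (h1.add h2).congr_deriv ?_
    simp [z']
  have hz' : ∀ t i, HasDerivAt (fun t => z' t i) (w i) t := fun t i => by
    exact (((hasDerivAt_id t).mul_const (w i)).const_add (x i)).congr_deriv (one_mul (w i))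
  have hpos : ∀ᶠ t in nhds (0 : ℝ), ∀ i, 0 < z t i := by
    rw [Filter.eventually_all]
    intro i
    exact (hz 0 i).continuousAt.eventually_const_lt (by simpa [z] using hl i)
  have hz0 : z 0 = l := by ext i; simp [z]
  have hz'0 : z' 0 = x := by ext i; simp [z']
  -- the curve of diagonal matrices
  let Δ : (Fin n → ℝ) →ₗ[ℝ] Matrix (Fin n) (Fin n) ℝ := diagonalLinearMap (Fin n) ℝ ℝ
  have hΔ : ∀ v, LinearMap.toContinuousLinearMap Δ v = diagonal v := fun _ => rfl
  have hy : ∀ t, HasDerivAt (fun t => diagonal (z t)) (diagonal (z' t)) t := fun t =>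
    (LinearMap.toContinuousLinearMap Δ).hasFDerivAt.comp_hasDerivAt t
      (hasDerivAt_pi.mpr (hz t))
  have hy' : HasDerivAt (fun t => diagonal (z' t)) (diagonal w) 0 :=
    (LinearMap.toContinuousLinearMap Δ).hasFDerivAt.comp_hasDerivAt (0 : ℝ)
      (hasDerivAt_pi.mpr (hz' 0))
  have hf : ContDiffAt ℝ 2 (isoEnergy n) (diagonal (z 0)) := by
    rw [hz0]; exact contDiffAt_isoEnergy _ hdet
  -- the principal stretches along the curve
  have hlog : ∀ t i, 0 < z t i →
      HasDerivAt (fun t => Real.log (z t i)) (z' t i / z t i) t := fun t i h =>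
    (hz t i).log h.ne'
  have hquot : ∀ i, HasDerivAt (fun t => z' t i / z t i) (w i / l i - (x i / l i) ^ 2) 0 := by
    intro i
    have hne : z 0 i ≠ 0 := by rw [hz0]; exact (hl i).ne'
    refine ((hz' 0 i).div (hz 0 i) hne).congr_deriv ?_
    rw [hz0, hz'0]
    have := (hl i).ne'
    field_simp
  have hg : ∀ᶠ t in nhds (0 : ℝ), HasDerivAt (fun t => stretchEnergy (z t))
      (∑ i, 2 * (Real.log (z t i) - 1 / (n : ℝ) * ∑ j, Real.log (z t j))
        * (z' t i / z t i - 1 / (n : ℝ) * ∑ j, z' t j / z t j)) t := by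
    filter_upwards [hpos] with t ht
    have h1 : ∀ i, HasDerivAt
        (fun t => Real.log (z t i) - 1 / (n : ℝ) * ∑ j, Real.log (z t j))
        (z' t i / z t i - 1 / (n : ℝ) * ∑ j, z' t j / z t j) t := fun i =>
      (hlog t i (ht i)).sub
        ((HasDerivAt.fun_sum fun j _ => hlog t j (ht j)).const_mul (1 / (n : ℝ)))
    refine (HasDerivAt.fun_sum fun i _ => (h1 i).fun_pow 2).congr_deriv ?_
    refine Finset.sum_congr rfl fun i _ => ?_
    norm_num
  have hg' : HasDerivAt (fun t =>
      ∑ i, 2 * (Real.log (z t i) - 1 / (n : ℝ) * ∑ j, Real.log (z t j))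
        * (z' t i / z t i - 1 / (n : ℝ) * ∑ j, z' t j / z t j))
      (∑ i, (2 * (x i / l i - 1 / (n : ℝ) * ∑ j, x j / l j) ^ 2
        + 2 * (Real.log (l i) - 1 / (n : ℝ) * ∑ j, Real.log (l j))
          * ((w i / l i - (x i / l i) ^ 2)
            - 1 / (n : ℝ) * ∑ j, (w j / l j - (x j / l j) ^ 2)))) 0 := by
    have hp0 : ∀ i, 0 < z 0 i := fun i => by rw [hz0]; exact hl i
    refine HasDerivAt.fun_sum fun i _ => ?_
    have h1 : HasDerivAt
        (fun t => Real.log (z t i) - 1 / (n : ℝ) * ∑ j, Real.log (z t j))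
        (z' 0 i / z 0 i - 1 / (n : ℝ) * ∑ j, z' 0 j / z 0 j) 0 :=
      (hlog 0 i (hp0 i)).sub
        ((HasDerivAt.fun_sum fun j _ => hlog 0 j (hp0 j)).const_mul (1 / (n : ℝ)))
    have h2 : HasDerivAt
        (fun t => z' t i / z t i - 1 / (n : ℝ) * ∑ j, z' t j / z t j)
        ((w i / l i - (x i / l i) ^ 2)
            - 1 / (n : ℝ) * ∑ j, (w j / l j - (x j / l j) ^ 2)) 0 :=
      (hquot i).sub ((HasDerivAt.fun_sum fun j _ => hquot j).const_mul (1 / (n : ℝ)))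
    refine ((h1.const_mul 2).mul h2).congr_deriv ?_
    rw [hz0, hz'0]
    ring
  have hfg : (fun t => isoEnergy n (diagonal (z t))) =ᶠ[nhds 0] fun t => stretchEnergy (z t) := by
    filter_upwards [hpos] with t ht
    exact isoEnergy_diagonal _ ht
  have h := (fderiv_curve_eq hfg (eventually_hasDerivAt_comp_curve hf hy) hg
    (hasDerivAt_fderiv_curve hf hy hy') hg').2
  rw [hz0, hz'0] at h
  exact h

end Energy

open Matrix in
/-- Second derivative of the isochoric energy at a diagonal matrix with distinct entries. -/
lemma isoEnergy_second_derivative {n : ℕ} (l : Fin n → ℝ) (hl : ∀ i, 0 < l i)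
    (hinj : Function.Injective l) (H : Matrix (Fin n) (Fin n) ℝ) :
    fderiv ℝ (fderiv ℝ (isoEnergy n)) (diagonal l) H H
      = ∑ i, (2 * (H i i / l i - 1 / (n : ℝ) * ∑ j, H j j / l j) ^ 2
        + 2 * (Real.log (l i) - 1 / (n : ℝ) * ∑ j, Real.log (l j))
          * (((∑ k, ((H i k ^ 2 + H k i ^ 2) * l i + 2 * (H i k * H k i) * l k)
                / (l i ^ 2 - l k ^ 2)) / l i - (H i i / l i) ^ 2)
            - 1 / (n : ℝ) * ∑ j, ((∑ k, ((H j k ^ 2 + H k j ^ 2) * l j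
                + 2 * (H j k * H k j) * l k) / (l j ^ 2 - l k ^ 2)) / l j
                - (H j j / l j) ^ 2))) := by
  have hdet : (diagonal l).det ≠ 0 := by
    rw [det_diagonal]; exact Finset.prod_ne_zero_iff.mpr fun i _ => (hl i).ne'
  have hne : ∀ i j, i ≠ j → l i ^ 2 - l j ^ 2 ≠ 0 := by
    intro i j hij h
    have h1 : l i = l j :=
      (pow_left_inj₀ (hl i).le (hl j).le two_ne_zero).mp (sub_eq_zero.mp h)
    exact hij (hinj h1)
  -- For `i ≠ j` the vanishing of the entries `(i, j)` and `(j, i)` of `A D + H + D B`, with `A`,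
  -- `B` skew, is a 2×2 linear system whose determinant is `l i ^ 2 - l j ^ 2`. On the diagonal the
  -- formulas read `x / 0 = 0`.
  let A : Matrix (Fin n) (Fin n) ℝ → Matrix (Fin n) (Fin n) ℝ := fun H =>
    of fun i j => (H i j * l j + H j i * l i) / (l i ^ 2 - l j ^ 2)
  let B : Matrix (Fin n) (Fin n) ℝ → Matrix (Fin n) (Fin n) ℝ := fun H =>
    of fun i j => -((H i j * l i + H j i * l j) / (l i ^ 2 - l j ^ 2))
  have hA : ∀ H, (A H)ᵀ = -A H := by
    intro H
    ext i j
    simp only [A, transpose_apply, of_apply, Matrix.neg_apply]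
    rw [← neg_sub (l i ^ 2), div_neg, add_comm]
  have hB : ∀ H, (B H)ᵀ = -B H := by
    intro H
    ext i j
    simp only [B, transpose_apply, of_apply, Matrix.neg_apply]
    rw [← neg_sub (l i ^ 2), div_neg, add_comm]
  have hK : ∀ H, A H * diagonal l + H + diagonal l * B H = diagonal (fun i => H i i) := by
    intro H
    ext i j
    simp only [Matrix.add_apply, mul_diagonal, diagonal_mul, A, B, of_apply]
    by_cases hij : i = j
    · subst hij; simp
    · have := hne i j hij
      rw [diagonal_apply_ne _ hij]
      field_simp
      ring
  -- The gradient sees only diagonal entries, so only the diagonal of the second-order correction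
  -- has to be computed.
  have hfirst : ∀ X, fderiv ℝ (isoEnergy n) (diagonal l) X
      = fderiv ℝ (isoEnergy n) (diagonal l) (diagonal fun i => X i i) := by
    intro X
    rw [(isoEnergy_derivatives_rotate (A X) (B X) (diagonal l) X (hA X) (hB X) hdet).1, hK]
  rw [(isoEnergy_derivatives_rotate (A H) (B H) (diagonal l) H (hA H) (hB H) hdet).2, hK, hfirst,
    isoEnergy_second_derivative_diagonal l _ _ hl]
  have hw : ∀ i, (A H * diagonal (fun i => H i i) + (A H * H + H * B H)
      + diagonal (fun i => H i i) * B H) i i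
      = ∑ k, ((H i k ^ 2 + H k i ^ 2) * l i + 2 * (H i k * H k i) * l k)
                / (l i ^ 2 - l k ^ 2) := by
    intro i
    simp only [Matrix.add_apply, mul_diagonal, diagonal_mul]
    rw [Matrix.mul_apply, Matrix.mul_apply, ← Finset.sum_add_distrib]
    simp only [A, B, of_apply, sub_self, div_zero, neg_zero, zero_mul, mul_zero, zero_add, add_zero]
    refine Finset.sum_congr rfl fun k _ => ?_
    rw [← neg_sub (l i ^ 2), div_neg]
    ring
  simp only [hw]

/-! ### Shear terms of pairs of stretches. -/

/-- The logarithmic mean is at most the arithmetic mean; this is `log (1 + x) ≥ 2 x / (x + 2)` at `x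
= a / b - 1`. -/
lemma two_mul_sub_div_add_le_log_sub_log {a b : ℝ} (hb : 0 < b) (hab : b ≤ a) :
    2 * (a - b) / (a + b) ≤ Real.log a - Real.log b := by
  have ha : 0 < a := hb.trans_le hab
  have h := Real.le_log_one_add_of_nonneg (x := a / b - 1) (by
    rw [sub_nonneg, one_le_div hb]; exact hab)
  rw [add_sub_cancel, Real.log_div ha.ne' hb.ne'] at h
  have h1 : a / b - 1 = (a - b) / b := by field_simp
  have h2 : (a - b) / b + 2 = (a + b) / b := by field_simp; ring
  rw [h1, h2, mul_div_assoc', div_div_div_cancel_right₀ hb.ne'] at h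
  exact h

/-- The shear contribution of a pair of distinct principal stretches. -/
lemma pair_contribution_bounds {a b s t p q : ℝ} (ha : 0 < a) (hb : 0 < b) (hab : a ≠ b)
    (hst : s - t = Real.log a - Real.log b) :
    let T := ((p ^ 2 + q ^ 2) * (s - t) + 2 * (p * q) * (s * b / a - t * a / b)) / (a ^ 2 - b ^ 2)
    let Y := p * q / (a * b)
    (0 ≤ Y → (2 - (s + t)) * Y ≤ T) ∧ (Y ≤ 0 → ((s - t) ^ 2 / 2 - (s + t)) * Y ≤ T) := by
  intro T Y
  have hsum : 0 < a + b := add_pos ha hb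
  have hsub : a - b ≠ 0 := sub_ne_zero.mpr hab
  set r := s - t with hr
  set u := 2 * (a - b) / (a + b) with hu
  have hu0 : u ≠ 0 := div_ne_zero (mul_ne_zero two_ne_zero hsub) hsum.ne'
  have hru : u ^ 2 ≤ r * u ∧ r * u ≤ r ^ 2 := by
    rcases lt_or_gt_of_ne hab with h | h
    · have h1 := two_mul_sub_div_add_le_log_sub_log ha h.le
      have h2 : 2 * (b - a) / (b + a) = -u := by
        rw [hu, add_comm b a, ← neg_div]; congr 1; ring
      have h3 : u < 0 := div_neg_of_neg_of_pos (by linarith) hsum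
      rw [h2] at h1
      have h4 : r ≤ u := by linarith
      constructor <;> nlinarith
    · have h1 := two_mul_sub_div_add_le_log_sub_log hb h.le
      have h3 : 0 < u := div_pos (by linarith) hsum
      have h4 : u ≤ r := by linarith
      constructor <;> nlinarith
  have hdiff : a ^ 2 - b ^ 2 = u / 2 * (a + b) ^ 2 := by
    rw [hu]; field_simp; ring
  have hd0 : a ^ 2 - b ^ 2 ≠ 0 := by
    rw [hdiff]; positivity
  have hκ : 0 ≤ r / (a ^ 2 - b ^ 2) := by
    have h1 : r / (a ^ 2 - b ^ 2) = r * u * (2 / (u ^ 2 * (a + b) ^ 2)) := by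
      rw [hdiff]; field_simp
    rw [h1]
    exact mul_nonneg (le_trans (sq_nonneg u) hru.1) (by positivity)
  -- The first summand has a nonnegative prefactor, so `p ^ 2 + q ^ 2` may be replaced by `2 p q` or
  -- `-2 p q`, whichever is nonnegative. The coefficient of `Y` becomes `2 r / u ≥ 2` or `r u / 2 ≤
  -- r ^ 2 / 2`.
  have hT : T = r / (a ^ 2 - b ^ 2) * (p ^ 2 + q ^ 2 + p * q * ((a ^ 2 + b ^ 2) / (a * b)))
      - (s + t) * Y := by
    simp only [T, Y, hr]
    field_simp
    ring
  constructor
  · intro hY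
    have h1 : r / (a ^ 2 - b ^ 2) * (2 * (p * q) + p * q * ((a ^ 2 + b ^ 2) / (a * b)))
        = 2 * (r / u) * Y := by
      rw [hdiff]; simp only [Y]; field_simp; ring
    have h2 : 1 ≤ r / u := by
      have : r / u = r * u / u ^ 2 := by field_simp
      rw [this, one_le_div (by positivity)]
      exact hru.1
    have h3 := mul_le_mul_of_nonneg_left
      (show 2 * (p * q) + p * q * ((a ^ 2 + b ^ 2) / (a * b))
        ≤ p ^ 2 + q ^ 2 + p * q * ((a ^ 2 + b ^ 2) / (a * b)) by nlinarith [sq_nonneg (p - q)]) hκ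
    rw [hT]
    nlinarith
  · intro hY
    have h1 : r / (a ^ 2 - b ^ 2) * (-2 * (p * q) + p * q * ((a ^ 2 + b ^ 2) / (a * b)))
        = r * u / 2 * Y := by
      have h0 : r / (a ^ 2 - b ^ 2) = r / ((a - b) * (a + b)) := by congr 1; ring
      rw [h0, hu]; simp only [Y]; field_simp; ring
    have h3 := mul_le_mul_of_nonneg_left
      (show -2 * (p * q) + p * q * ((a ^ 2 + b ^ 2) / (a * b))
        ≤ p ^ 2 + q ^ 2 + p * q * ((a ^ 2 + b ^ 2) / (a * b)) by nlinarith [sq_nonneg (p + q)]) hκ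
    rw [hT]
    nlinarith [hru.2]

/-! ### Nonnegativity of the quadratic form. -/

section QuadraticForm

variable {d₁ d₂ d₃ y₁ y₂ y₃ T₁₂ T₁₃ T₂₃ : ℝ}

lemma abs_le_two_thirds {a b c : ℝ} (h : a + b + c = 0) (hb : a ^ 2 + b ^ 2 + c ^ 2 ≤ 2 / 3) :
    |a| ≤ 2 / 3 := by
  obtain rfl : a = -b - c := by linarith
  exact abs_le_of_sq_le_sq (by nlinarith [sq_nonneg (b - c)]) (by norm_num)

/-- Completing the square needs only `m k ≥ 1/144`; the value `1/9` is what `one_ninth_le_mul`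
supplies. -/
lemma binaryForm_nonneg {m k x z : ℝ} (hm : 0 ≤ m) (hmk : 1 / 9 ≤ m * k) :
    0 ≤ m * x ^ 2 + k * z ^ 2 + 1 / 6 * (x * z) := by
  have hm' : 0 < m := lt_of_le_of_ne hm fun h => by rw [← h] at hmk; norm_num at hmk
  have h : 0 ≤ m * (m * x ^ 2 + k * z ^ 2 + 1 / 6 * (x * z)) := by
    have h1 := mul_le_mul_of_nonneg_right hmk (sq_nonneg z)
    nlinarith [sq_nonneg (m * x + z / 12)]
  exact nonneg_of_mul_nonneg_right h hm'

lemma ternaryForm_nonneg {m k r c x y z : ℝ} (hm : 2 / 3 ≤ m) (hk : 1 / 9 ≤ m * k)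
    (hr : 1 / 9 ≤ m * r) (hc : 2 / 3 ≤ c) (hyz : 0 ≤ y * z) :
    0 ≤ m * x ^ 2 + k * y ^ 2 + r * z ^ 2 + 1 / 6 * (x * y) + 1 / 6 * (x * z) + c * (y * z) := by
  have h : 0 ≤ m * (m * x ^ 2 + k * y ^ 2 + r * z ^ 2 + 1 / 6 * (x * y) + 1 / 6 * (x * z)
      + c * (y * z)) := by
    have k2 := mul_le_mul_of_nonneg_right hk (sq_nonneg y)
    have k3 := mul_le_mul_of_nonneg_right hr (sq_nonneg z)
    have hmc : 4 / 9 ≤ m * c := by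
      calc (4 : ℝ) / 9 = 2 / 3 * (2 / 3) := by norm_num
        _ ≤ m * c := mul_le_mul hm hc (by norm_num) (by linarith)
    have k4 := mul_le_mul_of_nonneg_right hmc hyz
    nlinarith [sq_nonneg (m * x + (y + z) / 12), sq_nonneg y, sq_nonneg z]
  exact nonneg_of_mul_nonneg_right h (lt_of_lt_of_le (by norm_num) hm)

lemma sq_sub_le_of_bound {a b c : ℝ} (h : a + b + c = 0) (hb : a ^ 2 + b ^ 2 + c ^ 2 ≤ 2 / 3) :
    (a - b) ^ 2 / 2 ≤ 2 / 3 - 3 / 2 * c ^ 2 := by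
  obtain rfl : c = -a - b := by linarith
  linarith

/-- The constraints give `a b ≥ c ^ 2 - 1/3`, so the product is at least `(c + 1/3) ^ 2`. -/
lemma one_ninth_le_mul {a b c : ℝ} (h : a + b + c = 0) (hb : a ^ 2 + b ^ 2 + c ^ 2 ≤ 2 / 3)
    (hc : 0 ≤ c) : 1 / 9 ≤ (2 / 3 - a) * (2 / 3 - b) := by
  have h2 : b = -a - c := by linarith
  subst h2
  linarith [sq_nonneg c]

/-- The parabola `d - 3/2 d ^ 2` has maximum `1/6`, at `d = 1/3`, and is nonpositive for `d ≤ 0`. -/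
lemma opposite_coefficient_bounds {d p : ℝ} (hp : p ≤ 0) :
    1 / 6 * p ≤ (d - 3 / 2 * d ^ 2) * p ∧ (d ≤ 0 → 0 ≤ (d - 3 / 2 * d ^ 2) * p) :=
  ⟨mul_le_mul_of_nonpos_right (by linarith [sq_nonneg (3 * d - 1)]) hp, fun h =>
    mul_nonneg_of_nonpos_of_nonpos (by linarith [sq_nonneg d]) hp⟩

lemma quadraticForm_nonneg_of_mul_nonneg (hd : d₁ + d₂ + d₃ = 0)
    (hb : d₁ ^ 2 + d₂ ^ 2 + d₃ ^ 2 ≤ 2 / 3)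
    (h₁₂ : 0 ≤ y₁ * y₂) (h₁₃ : 0 ≤ y₁ * y₃) (h₂₃ : 0 ≤ y₂ * y₃)
    (t₁₂ : (2 - (d₁ + d₂)) * (y₁ * y₂) ≤ T₁₂) (t₁₃ : (2 - (d₁ + d₃)) * (y₁ * y₃) ≤ T₁₃)
    (t₂₃ : (2 - (d₂ + d₃)) * (y₂ * y₃) ≤ T₂₃) :
    0 ≤ (2 / 3 - d₁) * y₁ ^ 2 + (2 / 3 - d₂) * y₂ ^ 2 + (2 / 3 - d₃) * y₃ ^ 2
      - 2 / 3 * (y₁ * y₂ + y₁ * y₃ + y₂ * y₃) + T₁₂ + T₁₃ + T₂₃ := by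
  have b1 := abs_le_two_thirds hd hb
  have b2 := abs_le_two_thirds (a := d₂) (b := d₁) (c := d₃) (by linarith) (by linarith)
  have b3 := abs_le_two_thirds (a := d₃) (b := d₁) (c := d₂) (by linarith) (by linarith)
  rw [abs_le] at b1 b2 b3
  have m1 := mul_nonneg (sub_nonneg.mpr b1.2) (sq_nonneg y₁)
  have m2 := mul_nonneg (sub_nonneg.mpr b2.2) (sq_nonneg y₂)
  have m3 := mul_nonneg (sub_nonneg.mpr b3.2) (sq_nonneg y₃)
  have p12 := mul_nonneg (show 0 ≤ 4 / 3 - (d₁ + d₂) by linarith) h₁₂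
  have p13 := mul_nonneg (show 0 ≤ 4 / 3 - (d₁ + d₃) by linarith) h₁₃
  have p23 := mul_nonneg (show 0 ≤ 4 / 3 - (d₂ + d₃) by linarith) h₂₃
  linarith

/-- The case where `y₁` is opposed in sign to `y₂` and `y₃`. The product `y₁ y₂` gets a coefficient
at most `d₃ - 3/2 d₃ ^ 2`, so it can do harm only if `d₃ > 0`; likewise `y₁ y₃` and `d₂`. -/
lemma quadraticForm_nonneg_of_mul_nonpos (hd : d₁ + d₂ + d₃ = 0)
    (hb : d₁ ^ 2 + d₂ ^ 2 + d₃ ^ 2 ≤ 2 / 3)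
    (h₁₂ : y₁ * y₂ ≤ 0) (h₁₃ : y₁ * y₃ ≤ 0) (h₂₃ : 0 ≤ y₂ * y₃)
    (t₁₂ : ((d₁ - d₂) ^ 2 / 2 - (d₁ + d₂)) * (y₁ * y₂) ≤ T₁₂)
    (t₁₃ : ((d₁ - d₃) ^ 2 / 2 - (d₁ + d₃)) * (y₁ * y₃) ≤ T₁₃)
    (t₂₃ : (2 - (d₂ + d₃)) * (y₂ * y₃) ≤ T₂₃) :
    0 ≤ (2 / 3 - d₁) * y₁ ^ 2 + (2 / 3 - d₂) * y₂ ^ 2 + (2 / 3 - d₃) * y₃ ^ 2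
      - 2 / 3 * (y₁ * y₂ + y₁ * y₃ + y₂ * y₃) + T₁₂ + T₁₃ + T₂₃ := by
  have e3 : d₁ = -d₂ - d₃ := by linarith
  have b1 := abs_le_two_thirds hd hb
  have b2 := abs_le_two_thirds (a := d₂) (b := d₁) (c := d₃) (by linarith) (by linarith)
  have b3 := abs_le_two_thirds (a := d₃) (b := d₁) (c := d₂) (by linarith) (by linarith)
  rw [abs_le] at b1 b2 b3
  have m1 := mul_nonneg (sub_nonneg.mpr b1.2) (sq_nonneg y₁)
  have m2 := mul_nonneg (sub_nonneg.mpr b2.2) (sq_nonneg y₂)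
  have m3 := mul_nonneg (sub_nonneg.mpr b3.2) (sq_nonneg y₃)
  have p23 := mul_nonneg (show 0 ≤ 4 / 3 - (d₂ + d₃) by linarith) h₂₃
  have hd' : d₁ + d₃ + d₂ = 0 := by linarith
  have hb' : d₁ ^ 2 + d₃ ^ 2 + d₂ ^ 2 ≤ 2 / 3 := by linarith
  have q12 := sq_sub_le_of_bound hd hb
  have q13 := sq_sub_le_of_bound hd' hb'
  have c12 : (d₃ - 3 / 2 * d₃ ^ 2) * (y₁ * y₂)
      ≤ ((d₁ - d₂) ^ 2 / 2 - (d₁ + d₂) - 2 / 3) * (y₁ * y₂) :=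
    mul_le_mul_of_nonpos_right (by linarith) h₁₂
  have c13 : (d₂ - 3 / 2 * d₂ ^ 2) * (y₁ * y₃)
      ≤ ((d₁ - d₃) ^ 2 / 2 - (d₁ + d₃) - 2 / 3) * (y₁ * y₃) :=
    mul_le_mul_of_nonpos_right (by linarith) h₁₃
  obtain ⟨s12, z12⟩ := opposite_coefficient_bounds (d := d₃) h₁₂
  obtain ⟨s13, z13⟩ := opposite_coefficient_bounds (d := d₂) h₁₃
  rcases le_total d₃ 0 with h3 | h3 <;> rcases le_total d₂ 0 with h2 | h2
  · have := z12 h3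
    have := z13 h2
    linarith
  · have := z12 h3
    have := binaryForm_nonneg (x := y₁) (z := y₃) (sub_nonneg.mpr b1.2) (one_ninth_le_mul hd' hb' h2)
    linarith
  · have := z13 h2
    have := binaryForm_nonneg (x := y₁) (z := y₂) (sub_nonneg.mpr b1.2) (one_ninth_le_mul hd hb h3)
    linarith
  -- Both products may do harm, but now `d₁ ≤ 0` gives `y₁ ^ 2` a coefficient of at least `2/3`.
  · have := ternaryForm_nonneg (x := y₁) (show 2 / 3 ≤ 2 / 3 - d₁ by linarith)
      (one_ninth_le_mul hd hb h3) (one_ninth_le_mul hd' hb' h2)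
      (show 2 / 3 ≤ 4 / 3 - (d₂ + d₃) by linarith) h₂₃
    linarith

end QuadraticForm

section QuadraticForm

variable {d₁ d₂ d₃ y₁ y₂ y₃ T₁₂ T₁₃ T₂₃ : ℝ}

/-- The quadratic form of the second derivative along rank-one directions is non-negative. -/
lemma quadraticForm_nonneg (hd : d₁ + d₂ + d₃ = 0) (hb : d₁ ^ 2 + d₂ ^ 2 + d₃ ^ 2 ≤ 2 / 3)
    (t₁₂ : (0 ≤ y₁ * y₂ → (2 - (d₁ + d₂)) * (y₁ * y₂) ≤ T₁₂) ∧
      (y₁ * y₂ ≤ 0 → ((d₁ - d₂) ^ 2 / 2 - (d₁ + d₂)) * (y₁ * y₂) ≤ T₁₂))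
    (t₁₃ : (0 ≤ y₁ * y₃ → (2 - (d₁ + d₃)) * (y₁ * y₃) ≤ T₁₃) ∧
      (y₁ * y₃ ≤ 0 → ((d₁ - d₃) ^ 2 / 2 - (d₁ + d₃)) * (y₁ * y₃) ≤ T₁₃))
    (t₂₃ : (0 ≤ y₂ * y₃ → (2 - (d₂ + d₃)) * (y₂ * y₃) ≤ T₂₃) ∧
      (y₂ * y₃ ≤ 0 → ((d₂ - d₃) ^ 2 / 2 - (d₂ + d₃)) * (y₂ * y₃) ≤ T₂₃)) :
    0 ≤ (2 / 3 - d₁) * y₁ ^ 2 + (2 / 3 - d₂) * y₂ ^ 2 + (2 / 3 - d₃) * y₃ ^ 2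
      - 2 / 3 * (y₁ * y₂ + y₁ * y₃ + y₂ * y₃) + T₁₂ + T₁₃ + T₂₃ := by
  have same : 0 ≤ y₁ * y₂ → 0 ≤ y₁ * y₃ → 0 ≤ y₂ * y₃ → 0 ≤ (2 / 3 - d₁) * y₁ ^ 2
      + (2 / 3 - d₂) * y₂ ^ 2 + (2 / 3 - d₃) * y₃ ^ 2
      - 2 / 3 * (y₁ * y₂ + y₁ * y₃ + y₂ * y₃) + T₁₂ + T₁₃ + T₂₃ := fun h₁ h₂ h₃ =>
    quadraticForm_nonneg_of_mul_nonneg hd hb h₁ h₂ h₃ (t₁₂.1 h₁) (t₁₃.1 h₂) (t₂₃.1 h₃)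
  have first : y₁ * y₂ ≤ 0 → y₁ * y₃ ≤ 0 → 0 ≤ y₂ * y₃ → 0 ≤ (2 / 3 - d₁) * y₁ ^ 2
      + (2 / 3 - d₂) * y₂ ^ 2 + (2 / 3 - d₃) * y₃ ^ 2
      - 2 / 3 * (y₁ * y₂ + y₁ * y₃ + y₂ * y₃) + T₁₂ + T₁₃ + T₂₃ := fun h₁ h₂ h₃ =>
    quadraticForm_nonneg_of_mul_nonpos hd hb h₁ h₂ h₃ (t₁₂.2 h₁) (t₁₃.2 h₂) (t₂₃.1 h₃)
  have second : y₁ * y₂ ≤ 0 → 0 ≤ y₁ * y₃ → y₂ * y₃ ≤ 0 → 0 ≤ (2 / 3 - d₁) * y₁ ^ 2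
      + (2 / 3 - d₂) * y₂ ^ 2 + (2 / 3 - d₃) * y₃ ^ 2
      - 2 / 3 * (y₁ * y₂ + y₁ * y₃ + y₂ * y₃) + T₁₂ + T₁₃ + T₂₃ := fun h₁ h₂ h₃ => by
    have h := quadraticForm_nonneg_of_mul_nonpos (d₁ := d₂) (d₂ := d₁) (d₃ := d₃) (y₁ := y₂)
      (y₂ := y₁) (y₃ := y₃) (by linarith) (by linarith) (by rwa [mul_comm]) h₃ h₂
      (le_of_eq_of_le (by ring) (t₁₂.2 h₁)) (t₂₃.2 h₃) (t₁₃.1 h₂)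
    linarith
  have third : 0 ≤ y₁ * y₂ → y₁ * y₃ ≤ 0 → y₂ * y₃ ≤ 0 → 0 ≤ (2 / 3 - d₁) * y₁ ^ 2
      + (2 / 3 - d₂) * y₂ ^ 2 + (2 / 3 - d₃) * y₃ ^ 2
      - 2 / 3 * (y₁ * y₂ + y₁ * y₃ + y₂ * y₃) + T₁₂ + T₁₃ + T₂₃ := fun h₁ h₂ h₃ => by
    have h := quadraticForm_nonneg_of_mul_nonpos (d₁ := d₃) (d₂ := d₁) (d₃ := d₂) (y₁ := y₃)
      (y₂ := y₁) (y₃ := y₂) (by linarith) (by linarith) (by rwa [mul_comm]) (by rwa [mul_comm]) h₁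
      (le_of_eq_of_le (by ring) (t₁₃.2 h₂)) (le_of_eq_of_le (by ring) (t₂₃.2 h₃)) (t₁₂.1 h₁)
    linarith
  -- Among three signs, either all agree or one is opposed to the other two.
  rcases le_total 0 y₁ with h1 | h1 <;> rcases le_total 0 y₂ with h2 | h2 <;>
    rcases le_total 0 y₃ with h3 | h3
  · exact same (mul_nonneg h1 h2) (mul_nonneg h1 h3) (mul_nonneg h2 h3)
  · exact third (mul_nonneg h1 h2) (mul_nonpos_of_nonneg_of_nonpos h1 h3)
      (mul_nonpos_of_nonneg_of_nonpos h2 h3)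
  · exact second (mul_nonpos_of_nonneg_of_nonpos h1 h2) (mul_nonneg h1 h3)
      (mul_nonpos_of_nonpos_of_nonneg h2 h3)
  · exact first (mul_nonpos_of_nonneg_of_nonpos h1 h2) (mul_nonpos_of_nonneg_of_nonpos h1 h3)
      (mul_nonneg_of_nonpos_of_nonpos h2 h3)
  · exact first (mul_nonpos_of_nonpos_of_nonneg h1 h2) (mul_nonpos_of_nonpos_of_nonneg h1 h3)
      (mul_nonneg h2 h3)
  · exact second (mul_nonpos_of_nonpos_of_nonneg h1 h2) (mul_nonneg_of_nonpos_of_nonpos h1 h3)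
      (mul_nonpos_of_nonneg_of_nonpos h2 h3)
  · exact third (mul_nonneg_of_nonpos_of_nonpos h1 h2) (mul_nonpos_of_nonpos_of_nonneg h1 h3)
      (mul_nonpos_of_nonpos_of_nonneg h2 h3)
  · exact same (mul_nonneg_of_nonpos_of_nonpos h1 h2) (mul_nonneg_of_nonpos_of_nonpos h1 h3)
      (mul_nonneg_of_nonpos_of_nonpos h2 h3)

end QuadraticForm

/-! ### Rank-one directions at a diagonal matrix. -/

/-- Collects the two terms `(i, k)` and `(k, i)` of the double sum in the Hessian, weighted by `d i
= s` and `d k = t`. -/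
lemma pair_contribution_eq {a b s t p q : ℝ} (ha : 0 < a) (hb : 0 < b) (hab : a ≠ b) :
    ((p ^ 2 + q ^ 2) * (s - t) + 2 * (p * q) * (s * b / a - t * a / b)) / (a ^ 2 - b ^ 2)
      = s * (((p ^ 2 + q ^ 2) * a + 2 * (p * q) * b) / (a ^ 2 - b ^ 2) / a)
        + t * (((q ^ 2 + p ^ 2) * b + 2 * (q * p) * a) / (b ^ 2 - a ^ 2) / b) := by
  have h1 : a - b ≠ 0 := sub_ne_zero.mpr hab
  have h2 : a + b ≠ 0 := (add_pos ha hb).ne'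
  have h3 : a ^ 2 - b ^ 2 ≠ 0 := by
    rw [show a ^ 2 - b ^ 2 = (a - b) * (a + b) by ring]; exact mul_ne_zero h1 h2
  have h4 : b ^ 2 - a ^ 2 = -(a ^ 2 - b ^ 2) := by ring
  rw [h4]
  generalize a ^ 2 - b ^ 2 = k at h3
  field_simp
  ring

open Matrix in
lemma rankOne_second_derivative_nonneg_of_injective (l : Fin 3 → ℝ) (hl : ∀ i, 0 < l i)
    (hinj : Function.Injective l) (hE : stretchEnergy l ≤ 2 / 3) (ξ η : Fin 3 → ℝ) :
    0 ≤ fderiv ℝ (fderiv ℝ (isoEnergy 3)) (diagonal l) (vecMulVec ξ η) (vecMulVec ξ η) := by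
  rw [isoEnergy_second_derivative l hl hinj]
  have h01 : l 0 ≠ l 1 := hinj.ne (by decide)
  have h02 : l 0 ≠ l 2 := hinj.ne (by decide)
  have h12 : l 1 ≠ l 2 := hinj.ne (by decide)
  simp only [stretchEnergy, Fin.sum_univ_three, vecMulVec_apply, sub_self, div_zero, Nat.cast_ofNat]
    at hE ⊢
  set m := 1 / (3 : ℝ) * (Real.log (l 0) + Real.log (l 1) + Real.log (l 2)) with hm
  have hd : (Real.log (l 0) - m) + (Real.log (l 1) - m) + (Real.log (l 2) - m) = 0 := by
    rw [hm]; ring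
  -- Rank one enters here: `H i j * H j i = H i i * H j j`.
  have y : ∀ i j, ξ i * η j * (ξ j * η i) / (l i * l j)
      = ξ i * η i / l i * (ξ j * η j / l j) := fun i j => by
    have := (hl i).ne'; have := (hl j).ne'
    field_simp
  have t01 := pair_contribution_bounds (s := Real.log (l 0) - m) (t := Real.log (l 1) - m)
    (p := ξ 0 * η 1) (q := ξ 1 * η 0) (hl 0) (hl 1) h01 (by ring)
  have t02 := pair_contribution_bounds (s := Real.log (l 0) - m) (t := Real.log (l 2) - m)
    (p := ξ 0 * η 2) (q := ξ 2 * η 0) (hl 0) (hl 2) h02 (by ring)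
  have t12 := pair_contribution_bounds (s := Real.log (l 1) - m) (t := Real.log (l 2) - m)
    (p := ξ 1 * η 2) (q := ξ 2 * η 1) (hl 1) (hl 2) h12 (by ring)
  simp only [pair_contribution_eq (hl 0) (hl 1) h01, pair_contribution_eq (hl 0) (hl 2) h02,
    pair_contribution_eq (hl 1) (hl 2) h12, y] at t01 t02 t12
  have h := quadraticForm_nonneg hd hE t01 t02 t12
  simp only [zero_add, add_zero, add_div] at h ⊢
  clear t01 t02 t12 y hE
  generalize Real.log (l 0) - m = d0 at *
  generalize Real.log (l 1) - m = d1 at *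
  generalize Real.log (l 2) - m = d2 at *
  obtain rfl : d2 = -d0 - d1 := by linarith
  -- The Hessian is twice the form; the averaged second-order terms drop out because the `d i` sum
  -- to zero.
  refine le_of_le_of_eq (mul_nonneg zero_le_two h) ?_
  ring

lemma stretchEnergy_exp {n : ℕ} (u : Fin n → ℝ) :
    stretchEnergy (fun i => Real.exp (u i)) = ∑ i, (u i - 1 / (n : ℝ) * ∑ j, u j) ^ 2 := by
  simp [stretchEnergy]

open Matrix in
lemma rankOne_second_derivative_nonneg_diagonal (l : Fin 3 → ℝ) (hl : ∀ i, 0 < l i)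
    (hE : stretchEnergy l ≤ 2 / 3) (ξ η : Fin 3 → ℝ) :
    0 ≤ fderiv ℝ (fderiv ℝ (isoEnergy 3)) (diagonal l) (vecMulVec ξ η) (vecMulVec ξ η) := by
  have hdet : (diagonal l).det ≠ 0 := by
    rw [det_diagonal]; exact Finset.prod_ne_zero_iff.mpr fun i _ => (hl i).ne'
  -- Distinct entries, mean zero and square sum `1/2 ≤ 2/3`: moving the logarithms towards `e`
  -- separates equal stretches and, by convexity of the square, keeps the energy bound.
  let e : Fin 3 → ℝ := ![1 / 2, 0, -1 / 2]
  let u : ℝ → Fin 3 → ℝ := fun ε i => (1 - ε) * Real.log (l i) + ε * e i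
  let k : ℝ → Fin 3 → ℝ := fun ε i => Real.exp (u ε i)
  have hk0 : k 0 = l := by
    ext i
    simp [k, u, Real.exp_log (hl i)]
  have hkpos : ∀ ε i, 0 < k ε i := fun ε i => Real.exp_pos _
  have hcont : ∀ i, Continuous fun ε => u ε i := fun i => by fun_prop
  have hkE : ∀ ε, 0 ≤ ε → ε ≤ 1 → stretchEnergy (k ε) ≤ 2 / 3 := by
    intro ε h0 h1
    have hsq : ∀ a b : ℝ, ((1 - ε) * a + ε * b) ^ 2 ≤ (1 - ε) * a ^ 2 + ε * b ^ 2 := fun a b => by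
      nlinarith [mul_nonneg (mul_nonneg h0 (sub_nonneg.mpr h1)) (sq_nonneg (a - b))]
    have hterm : ∀ i, u ε i - 1 / ((3 : ℕ) : ℝ) * ∑ j, u ε j
        = (1 - ε) * (Real.log (l i) - 1 / ((3 : ℕ) : ℝ) * ∑ j, Real.log (l j)) + ε * e i := by
      intro i
      simp only [u, e, Fin.sum_univ_three, Matrix.cons_val_zero, Matrix.cons_val_one,
        Matrix.cons_val]
      ring
    have hesq : ∑ i, e i ^ 2 = 1 / 2 := by
      simp [e, Fin.sum_univ_three]; norm_num
    calc stretchEnergy (k ε)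
        = ∑ i, (u ε i - 1 / ((3 : ℕ) : ℝ) * ∑ j, u ε j) ^ 2 := stretchEnergy_exp (u ε)
      _ ≤ ∑ i, ((1 - ε) * (Real.log (l i) - 1 / ((3 : ℕ) : ℝ) * ∑ j, Real.log (l j)) ^ 2
            + ε * e i ^ 2) := Finset.sum_le_sum fun i _ => by rw [hterm]; exact hsq _ _
      _ = (1 - ε) * stretchEnergy l + ε * (1 / 2) := by
          rw [Finset.sum_add_distrib, ← Finset.mul_sum, ← Finset.mul_sum, hesq, stretchEnergy]
      _ ≤ 2 / 3 := by nlinarith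
  have hinj : ∀ᶠ ε in nhdsWithin (0 : ℝ) (Set.Ioi 0), Function.Injective (k ε) := by
    have hpair : ∀ i j, i ≠ j → ∀ᶠ ε in nhdsWithin (0 : ℝ) (Set.Ioi 0), u ε i ≠ u ε j := by
      intro i j hij
      by_cases h : Real.log (l i) = Real.log (l j)
      · filter_upwards [self_mem_nhdsWithin] with ε hε heq
        have he : e i = e j := by
          simp only [u, h] at heq
          exact mul_left_cancel₀ (ne_of_gt hε) (add_left_cancel heq)
        revert he
        fin_cases i <;> fin_cases j <;> simp [e] at hij ⊢ <;> norm_num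
      · have h0 : u 0 i - u 0 j ≠ 0 := by
          simpa [u] using sub_ne_zero.mpr h
        have h1 : ∀ᶠ ε in nhds (0 : ℝ), u ε i - u ε j ≠ 0 :=
          ((hcont i).sub (hcont j)).continuousAt.eventually_ne h0
        filter_upwards [nhdsWithin_le_nhds h1] with ε hε
        exact sub_ne_zero.mp hε
    have hall : ∀ᶠ ε in nhdsWithin (0 : ℝ) (Set.Ioi 0), ∀ i j, i ≠ j → u ε i ≠ u ε j := by
      simp only [Filter.eventually_all]
      exact hpair
    filter_upwards [hall] with ε hε i j hij
    by_contra hne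
    exact hε i j hne (Real.exp_injective hij)
  have hfd : ContinuousAt (fderiv ℝ (fderiv ℝ (isoEnergy 3))) (diagonal (k 0)) := by
    rw [hk0]
    have h2 : ContDiffAt ℝ 2 (isoEnergy 3) (diagonal l) := contDiffAt_isoEnergy _ hdet
    exact ((h2.fderiv_right (m := 1) (by norm_num)).fderiv_right (m := 0)
      (by norm_num)).continuousAt
  have hkc : Continuous fun ε => diagonal (k ε) := by
    refine Continuous.matrix_diagonal (continuous_pi fun i => Real.continuous_exp.comp (hcont i))
  have hlim : Filter.Tendsto
      (fun ε => fderiv ℝ (fderiv ℝ (isoEnergy 3)) (diagonal (k ε)) (vecMulVec ξ η) (vecMulVec ξ η))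
      (nhdsWithin (0 : ℝ) (Set.Ioi 0))
      (nhds (fderiv ℝ (fderiv ℝ (isoEnergy 3)) (diagonal l) (vecMulVec ξ η) (vecMulVec ξ η))) := by
    have h1 : ContinuousAt (fun ε => fderiv ℝ (fderiv ℝ (isoEnergy 3)) (diagonal (k ε))) 0 :=
      ContinuousAt.comp (f := fun ε => diagonal (k ε)) hfd hkc.continuousAt
    have h2 := ((h1.clm_apply continuousAt_const).clm_apply
      (continuousAt_const (y := vecMulVec ξ η))).tendsto (f := fun ε =>
        fderiv ℝ (fderiv ℝ (isoEnergy 3)) (diagonal (k ε)) (vecMulVec ξ η) (vecMulVec ξ η))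
    rw [hk0] at h2
    exact h2.mono_left nhdsWithin_le_nhds
  refine ge_of_tendsto hlim ?_
  filter_upwards [hinj, Ioo_mem_nhdsGT (zero_lt_one' ℝ)] with ε h1 h2
  exact rankOne_second_derivative_nonneg_of_injective (k ε) (hkpos ε) h1
    (hkE ε h2.1.le h2.2.le) ξ η

/-! ### Reduction of a general matrix to a diagonal one. -/

open Matrix in
lemma isoEnergy_second_derivative_orthogonal {n : ℕ} (Q R F H : Matrix (Fin n) (Fin n) ℝ)
    (hQ : Qᵀ * Q = 1) (hR : Rᵀ * R = 1) (hF : F.det ≠ 0) :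
    fderiv ℝ (fderiv ℝ (isoEnergy n)) F H H
      = fderiv ℝ (fderiv ℝ (isoEnergy n)) (Q * F * R) (Q * H * R) (Q * H * R) := by
  have hdet : ∀ {S : Matrix (Fin n) (Fin n) ℝ}, Sᵀ * S = 1 → S.det ≠ 0 := fun h h0 => by
    have := congrArg det h
    rw [det_mul, h0, mul_zero, det_one] at this
    exact zero_ne_one this
  have hF' : (Q * F * R).det ≠ 0 := by
    rw [det_mul, det_mul]
    exact mul_ne_zero (mul_ne_zero (hdet hQ) hF) (hdet hR)
  have hy : ∀ (F H : Matrix (Fin n) (Fin n) ℝ) (t : ℝ),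
      HasDerivAt (fun t : ℝ => F + t • H) H t := fun F H t =>
    (((hasDerivAt_id t).smul_const H).const_add F).congr_deriv (one_smul ℝ H)
  have hf : ∀ (F H : Matrix (Fin n) (Fin n) ℝ), F.det ≠ 0 →
      ContDiffAt ℝ 2 (isoEnergy n) (F + (0 : ℝ) • H) := fun F H hF => by
    rw [zero_smul, add_zero]
    exact contDiffAt_isoEnergy F hF
  have heq : (fun t : ℝ => isoEnergy n (F + t • H)) =ᶠ[nhds 0]
      fun t => isoEnergy n (Q * F * R + t • (Q * H * R)) := by
    have hcont : Continuous fun t : ℝ => (F + t • H).det := by fun_prop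
    have : ∀ᶠ t in nhds (0 : ℝ), (F + t • H).det ≠ 0 :=
      hcont.continuousAt.eventually_ne (by simpa using hF)
    filter_upwards [this] with t ht
    rw [← isoEnergy_orthogonal_mul_mul Q R _ hQ hR ht]
    congr 1
    simp only [Matrix.mul_add, Matrix.add_mul, Matrix.mul_smul, Matrix.smul_mul]
  have h := (fderiv_curve_eq heq
    (eventually_hasDerivAt_comp_curve (y := fun t : ℝ => F + t • H) (hf F H hF) (hy F H))
    (eventually_hasDerivAt_comp_curve (y := fun t : ℝ => Q * F * R + t • (Q * H * R))
      (hf _ _ hF') (hy _ _))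
    (hasDerivAt_fderiv_curve (y := fun t : ℝ => F + t • H) (hf F H hF) (hy F H)
      (hasDerivAt_const 0 H))
    (hasDerivAt_fderiv_curve (y := fun t : ℝ => Q * F * R + t • (Q * H * R)) (hf _ _ hF') (hy _ _)
      (hasDerivAt_const 0 (Q * H * R)))).2
  simp only [zero_smul, add_zero, map_zero] at h
  exact h

open Matrix in
lemma mem_stretchDomain_iff {n : ℕ} (F : Matrix (Fin n) (Fin n) ℝ) (c : ℝ) (hF : F.det ≠ 0) :
    stretch F ∈ stretchDomain n c ↔ isoEnergy n F ≤ c := by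
  obtain ⟨Q, R, l, hQ, hR, hl, rfl⟩ := exists_svd F hF
  have hpd : (stretch (Q * diagonal l * R)).PosDef := by
    rw [stretch_svd Q R hQ hR l hl]
    have h := (PosDef.diagonal hl).conjTranspose_mul_mul_same (B := R)
      (mulVec_injective_iff_isUnit.mpr (IsUnit.of_mul_eq_one_right _ hR))
    rwa [conjTranspose_eq_transpose_of_trivial] at h
  exact ⟨fun h => h.2, fun h => ⟨hpd, h⟩⟩

open Matrix in
lemma mem_maximalEllipticityDomain_of_isoEnergy_le (F : Matrix (Fin 3) (Fin 3) ℝ)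
    (hF : F ∈ GLPos 3) (hE : isoEnergy 3 F ≤ 2 / 3) :
    F ∈ maximalEllipticityDomain (isoEnergy 3) := by
  have hdet : F.det ≠ 0 := ne_of_gt hF
  refine ⟨hF, contDiffAt_isoEnergy F hdet, fun ξ η => ?_⟩
  rw [iteratedFDeriv_two_apply]
  obtain ⟨Q, R, l, hQ, hR, hl, rfl⟩ := exists_svd F hdet
  have hR' : R * Rᵀ = 1 := mul_eq_one_comm.mp hR
  rw [isoEnergy_svd Q R hQ hR l hl] at hE
  have h1 : Qᵀ * (Q * diagonal l * R) * Rᵀ = diagonal l := by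
    calc _ = (Qᵀ * Q) * diagonal l * (R * Rᵀ) := by simp only [Matrix.mul_assoc]
      _ = _ := by rw [hQ, hR', Matrix.one_mul, Matrix.mul_one]
  -- Orthogonal changes of frame keep directions of rank at most one.
  have h2 : Qᵀ * vecMulVec ξ η * Rᵀ = vecMulVec (Qᵀ *ᵥ ξ) (R *ᵥ η) := by
    rw [mul_vecMulVec, vecMulVec_mul, vecMul_transpose]
  have h3 := isoEnergy_second_derivative_orthogonal Qᵀ Rᵀ (Q * diagonal l * R) (vecMulVec ξ η)
    (by rw [transpose_transpose]; exact mul_eq_one_comm.mp hQ)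
    (by rw [transpose_transpose]; exact hR') hdet
  rw [h1, h2] at h3
  have h4 := rankOne_second_derivative_nonneg_diagonal l hl hE (Qᵀ *ᵥ ξ) (R *ᵥ η)
  rw [← h3] at h4
  exact h4

/-! ### The bound in terms of ratios of stretches, and the main theorem. -/

open Matrix in
lemma charpoly_conjDiagonal_roots {n : ℕ} (R : Matrix (Fin n) (Fin n) ℝ) (hR : Rᵀ * R = 1)
    (y : Fin n → ℝ) :
    (Rᵀ * diagonal y * R).charpoly.roots = Finset.univ.val.map y := by
  rw [charpoly_mul_comm, ← Matrix.mul_assoc, mul_eq_one_comm.mp hR, Matrix.one_mul,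
    charpoly_diagonal]
  exact Polynomial.roots_multiset_prod_X_sub_C (Finset.univ.val.map y) ▸ by
    rw [Multiset.map_map]; rfl

/-- The energy of three principal stretches in terms of logarithms of their ratios, for any ordering
of the stretches. -/
lemma stretchEnergy_eq_of_multiset (l : Fin 3 → ℝ) (hl : ∀ i, 0 < l i) (l₁ l₂ l₃ : ℝ)
    (h : Finset.univ.val.map l = ({l₁, l₂, l₃} : Multiset ℝ)) :
    stretchEnergy l = 2 / 3 * (Real.log (l₁ / l₂) ^ 2 + Real.log (l₂ / l₃) ^ 2
          + Real.log (l₁ / l₂) * Real.log (l₂ / l₃)) := by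
  have hmem : ∀ x ∈ ({l₁, l₂, l₃} : Multiset ℝ), x ≠ 0 := by
    rw [← h]
    intro x hx
    obtain ⟨i, -, rfl⟩ := Multiset.mem_map.mp hx
    exact (hl i).ne'
  -- Symmetric sums depend only on the multiset, so the order of the eigenvalues is irrelevant.
  have hsum : ∀ f : ℝ → ℝ, f (l 0) + f (l 1) + f (l 2) = f l₁ + f l₂ + f l₃ := by
    intro f
    have h1 := congrArg (fun s => (Multiset.map f s).sum) h
    simp only [Multiset.map_map] at h1
    have h2 : (Multiset.map (f ∘ l) Finset.univ.val).sum = ∑ i, f (l i) := rfl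
    rw [h2, Fin.sum_univ_three] at h1
    rw [h1]
    simp [add_assoc]
  have s1 := hsum Real.log
  have s2 := hsum fun x => Real.log x ^ 2
  rw [Real.log_div (hmem _ (by simp)) (hmem _ (by simp)),
    Real.log_div (hmem _ (by simp)) (hmem _ (by simp))]
  simp only [stretchEnergy, Fin.sum_univ_three, Nat.cast_ofNat]
  have h3 : ∀ a b c : ℝ, (a - 1 / 3 * (a + b + c)) ^ 2 + (b - 1 / 3 * (a + b + c)) ^ 2
      + (c - 1 / 3 * (a + b + c)) ^ 2 = (a ^ 2 + b ^ 2 + c ^ 2) - 1 / 3 * (a + b + c) ^ 2 := by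
    intro a b c; ring
  rw [h3, s1]
  rw [s2]
  ring

/-- The energy `F ↦ ‖dev₃ log U‖²` is Legendre-Hadamard elliptic at every `F ∈ GL⁺(3)` whose stretch
satisfies `‖dev₃ log U‖² ≤ 2/3`; and if `l₁, l₂, l₃` are the principal stretches of `F` (the
eigenvalues of `U` with multiplicity, in any order), this bound is equivalent to
`a² + b² + a b ≤ 1` with `a = log (l₁/l₂)`, `b = log (l₂/l₃)`. -/
theorem proposition4p1 :
    (∀ F ∈ GLPos 3, stretch F ∈ stretchDomain 3 (2 / 3) →
      F ∈ maximalEllipticityDomain (isoEnergy 3)) ∧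
    (∀ F ∈ GLPos 3, ∀ l₁ l₂ l₃ : ℝ,
      (stretch F).charpoly.roots = ({l₁, l₂, l₃} : Multiset ℝ) →
      (stretch F ∈ stretchDomain 3 (2 / 3) ↔
        Real.log (l₁ / l₂) ^ 2 + Real.log (l₂ / l₃) ^ 2
          + Real.log (l₁ / l₂) * Real.log (l₂ / l₃) ≤ 1)) := by
  refine ⟨fun F hF h => mem_maximalEllipticityDomain_of_isoEnergy_le F hF h.2,
    fun F hF l₁ l₂ l₃ hroots => ?_⟩
  have hdet : F.det ≠ 0 := ne_of_gt hF
  rw [mem_stretchDomain_iff F _ hdet]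
  obtain ⟨Q, R, l, hQ, hR, hl, rfl⟩ := exists_svd F hdet
  rw [stretch_svd Q R hQ hR l hl, charpoly_conjDiagonal_roots R hR] at hroots
  rw [isoEnergy_svd Q R hQ hR l hl, stretchEnergy_eq_of_multiset l hl l₁ l₂ l₃ hroots]
  constructor <;> intro h <;> linarith
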